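/- Let $A^*$ be the operator $A^*(\xi,\eta)=(\xi'+\eta',\ \eta''+\eta'+\xi')$ with domain $$D(A^*)=\Big\{(\xi,\eta)\in H^1(0,1)\times H^2(0,1):\ \int_0^1\xi=0,\ \xi(0)=\xi(1),\ \eta(0)=\eta(1)=0\Big\}$$ (complex-valued functions), and let $\mathcal B^*_\rho(\xi,\eta)=\xi(1)$ for $(\xi,\eta)\in D(A^*)$. For $\lambda\in\mathbb C\setminus\{0\}$ let $m_1,m_2,m_3$ be the roots, with multiplicity, of $m^3-\lambda m^2-2\lambda m+\lambda^2$, and put $$\eta_\lambda(x)=(e^{m_2}-e^{m_3})e^{m_1x}+(e^{m_3}-e^{m_1})e^{m_2x}+(e^{m_1}-e^{m_2})e^{m_3x},\qquad \xi_\lambda=\frac{\eta_\lambda''-\lambda\eta_\lambda}{-\lambda};$$ the pair $(\xi_\lambda,\eta_\lambda)$ does not depend on the labelling of the roots, up to a sign. Let $k_0\ge 1$ be an integer. * A parabolic branch from $k_0$ on consists, for each integer $k\ge k_0$, of an eigenvalue $\lambda^p_k=-\big((k\pi+c_k)+i\,d_k\big)^2$ of $A^*$ with $c_k,d_k\in\mathbb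 R$, $|c_k|,|d_k|\le \pi/2$, and of the function $\Phi_{\lambda^p_k}=(\xi_{\lambda},\eta_{\lambda})$ with $\lambda=\lambda^p_k$, which is an eigenfunction of $A^*$ for $\lambda^p_k$. * A hyperbolic branch from $k_0$ on consists, for each $k\in\mathbb Z$ with $|k|\ge k_0$, of an eigenvalue $\lambda^h_k=-1-\alpha_{1,k}-i(2k\pi+\alpha_{2,k})$ of $A^*$ with $\alpha_{1,k},\alpha_{2,k}\in\mathbb R$, $|\alpha_{1,k}|,|\alpha_{2,k}|\le\pi/2$, and of the function $\Phi_{\lambda^h_k}=\big(k\pi\,e^{\sqrt{|k\pi|}+1/\sqrt{|k|}}\big)^{-1}(\xi_\lambda,\eta_\lambda)$ with $\lambda=\lambda^h_k$, which is an eigenfunction of $A^*$ for $\lambda^h_k$. **Lemma.** Both branches exist from some $k_0\ge1$ on. For every $k_0\ge 1$ and every parabolic branch from $k_0$ on, there is a constant $C>0$, independent of $k$, such that $$|\mathcal B^*_\rho\Phi_{\lambda^p_k}|\ \ge\ \frac{C}{k\pi}\qquad\text{for all } k\ge k_0;$$ and for every $k_0\ge1$ and every hyperbolic branch from $k_0$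 on, there is a constant $C>0$, independent of $k$, such that $$|\mathcal B^*_\rho\Phi_{\lambda^h_k}|\ \ge\ C\qquad\text{for all } k\in\mathbb Z,\ |k|\ge k_0.$$ -/

import Mathlib

open MeasureTheory Set

noncomputable section

/-- A pair `Φ = (ξ, η)` of complex-valued functions; only the values on `[0, 1]` matter. -/
abbrev State : Type := (ℝ → ℂ) × (ℝ → ℂ)

/-- `f` is (the continuous representative of) an element of `H¹(0,1)` and its weak derivative is
`g ∈ L²(0,1)`: the standard description of `H¹(0,1)` by absolutely continuous functions. -/
def HasL2Deriv (f g : ℝ → ℂ) : Prop :=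
  MemLp g 2 (volume.restrict (Icc (0 : ℝ) 1)) ∧
    ∀ x ∈ Icc (0 : ℝ) 1, f x = f 0 + ∫ t in (0 : ℝ)..x, g t

/-- The graph of the operator `A* (ξ, η) = (ξ' + η', η'' + η' + ξ')` with domain
`{(ξ, η) ∈ H¹(0,1) × H²(0,1) : ∫ ξ = 0, ξ(0) = ξ(1), η(0) = η(1) = 0}`:
`AdjointGraph Φ Ψ` says that `Φ` lies in the domain and that `A* Φ = Ψ` almost everywhere. -/
def AdjointGraph (Φ Ψ : State) : Prop :=
  ∃ dξ dη ddη : ℝ → ℂ,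
    HasL2Deriv Φ.1 dξ ∧ HasL2Deriv Φ.2 dη ∧ HasL2Deriv dη ddη ∧
    (∫ x in (0 : ℝ)..1, Φ.1 x) = 0 ∧ Φ.1 0 = Φ.1 1 ∧ Φ.2 0 = 0 ∧ Φ.2 1 = 0 ∧
    (∀ᵐ x ∂(volume.restrict (Icc (0 : ℝ) 1)), dξ x + dη x = Ψ.1 x) ∧
    (∀ᵐ x ∂(volume.restrict (Icc (0 : ℝ) 1)), ddη x + dη x + dξ x = Ψ.2 x)

/-- `Φ` is an eigenfunction of `A*` for the eigenvalue `lam`. -/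
def IsEigenfunction (lam : ℂ) (Φ : State) : Prop :=
  AdjointGraph Φ (lam • Φ) ∧ ∃ x ∈ Icc (0 : ℝ) 1, Φ.1 x ≠ 0 ∨ Φ.2 x ≠ 0

/-- The observation operator `B*_ρ (ξ, η) = ξ(1)`. -/
def observation (Φ : State) : ℂ := Φ.1 1

/-- `m₁, m₂, m₃` are the roots, with multiplicity, of `m³ - lam m² - 2 lam m + lam²`, the
characteristic polynomial of the third order equation satisfied by `η`. -/
def IsCharRoots (lam m₁ m₂ m₃ : ℂ) : Prop :=
  ∀ m : ℂ, m ^ 3 - lam * m ^ 2 - 2 * lam * m + lam ^ 2 = (m - m₁) * (m - m₂) * (m - m₃)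

/-- The second component
`η(x) = (e^{m₂} - e^{m₃}) e^{m₁ x} + (e^{m₃} - e^{m₁}) e^{m₂ x} + (e^{m₁} - e^{m₂}) e^{m₃ x}`. -/
def etaFun (m₁ m₂ m₃ : ℂ) (x : ℝ) : ℂ :=
  (Complex.exp m₂ - Complex.exp m₃) * Complex.exp (m₁ * x) +
  (Complex.exp m₃ - Complex.exp m₁) * Complex.exp (m₂ * x) +
  (Complex.exp m₁ - Complex.exp m₂) * Complex.exp (m₃ * x)

/-- The first component `ξ = (η'' + μ η) / μ` with `μ = -lam`, for `η = etaFun m₁ m₂ m₃`. -/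
def xiFun (lam m₁ m₂ m₃ : ℂ) (x : ℝ) : ℂ :=
  ((m₁ ^ 2 + -lam) / -lam) * (Complex.exp m₂ - Complex.exp m₃) * Complex.exp (m₁ * x) +
  ((m₂ ^ 2 + -lam) / -lam) * (Complex.exp m₃ - Complex.exp m₁) * Complex.exp (m₂ * x) +
  ((m₃ ^ 2 + -lam) / -lam) * (Complex.exp m₁ - Complex.exp m₂) * Complex.exp (m₃ * x)

/-- `Φ = (ξ, η)` is given by the formulas above for some labelling of the characteristic roots.
(A relabelling changes `(ξ, η)` at most by a sign.) -/
def IsReference (lam : ℂ) (Φ : State) : Prop :=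
  ∃ m₁ m₂ m₃ : ℂ, IsCharRoots lam m₁ m₂ m₃ ∧ Φ = (xiFun lam m₁ m₂ m₃, etaFun m₁ m₂ m₃)

/-- The scalar `kπ e^{√|kπ| + 1/√|k|}` by which the hyperbolic eigenfunctions are divided. -/
def hypScale (k : ℤ) : ℝ :=
  k * Real.pi * Real.exp (Real.sqrt |k * Real.pi| + 1 / Real.sqrt |(k : ℝ)|)

/-- `lam k` (`k ≥ k₀`) is an eigenvalue of `A*` of the form `-((kπ + c_k) + i d_k)²` with
`|c_k|, |d_k| ≤ π/2`, and `Φ k` is the eigenfunction given by the reference formulas. -/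
def IsParabolicBranch (k₀ : ℕ) (lam : ℕ → ℂ) (Φ : ℕ → State) : Prop :=
  ∀ k : ℕ, k₀ ≤ k →
    (∃ c d : ℝ, |c| ≤ Real.pi / 2 ∧ |d| ≤ Real.pi / 2 ∧
      lam k = -(((k * Real.pi + c : ℝ) : ℂ) + d * Complex.I) ^ 2) ∧
    IsEigenfunction (lam k) (Φ k) ∧ IsReference (lam k) (Φ k)

/-- `lam k` (`|k| ≥ k₀`) is an eigenvalue of `A*` of the form `-(1 + α₁) - i (2kπ + α₂)` with
`|α₁|, |α₂| ≤ π/2`, and `Φ k` is the eigenfunction given by the reference formulas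
divided by `kπ e^{√|kπ| + 1/√|k|}`. -/
def IsHyperbolicBranch (k₀ : ℕ) (lam : ℤ → ℂ) (Φ : ℤ → State) : Prop :=
  ∀ k : ℤ, (k₀ : ℤ) ≤ |k| →
    (∃ a b : ℝ, |a| ≤ Real.pi / 2 ∧ |b| ≤ Real.pi / 2 ∧
      lam k = -(((1 + a : ℝ) : ℂ) + ((2 * k * Real.pi + b : ℝ) : ℂ) * Complex.I)) ∧
    IsEigenfunction (lam k) (Φ k) ∧
    ∃ Φ₀ : State, IsReference (lam k) Φ₀ ∧ Φ k = ((hypScale k : ℂ)⁻¹) • Φ₀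

end

noncomputable section

/-! The characteristic cubic is a rational curve. With `t = lam / m - 1` it reads `m = t - 1/t`,
hence `lam = t² + t - 1 - 1/t`, and the shift `t = z - 1/2` removes the linear term: `lam =
specParam z`, which is `z²` up to a bounded error. One root, `rootB z`, is rational in `z`; the
other two solve a quadratic. For large `z` the roots are `A ≈ z² - 1/4`, `B ≈ z - 1/2`, `C ≈ -z -
1/2`, with errors tending to `0`, so both `ξ(1) = -obsNum / lam` and the eigenvalue condition
`eigNum = 0`, which is `ξ(0) = ξ(1)`, have explicit asymptotics.

Parabolic regime, `Re z` bounded: `e^A` decays faster than any power of `z`, `eigNum / z⁴` is close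
to `-2 e^{-1/2} sinh z`, and `obsNum / z` tends to `-2/e`. Thus `z ≈ ±ikπ` and `|ξ(1)| ≈ 2 / (e
|z|)`.

Hyperbolic regime, `Re z²` bounded and `Re z ≥ 0`: `e^B` is large, `e^C` is small, and `e^A` is
bounded above and away from `0`. Then `eigNum` is close to `z⁴ e^B (e^{z² - 1/4} - 1)` and `obsNum`
to `z⁴ e^{A + B}`. Thus `z² - 1/4 ≈ -2πik`, and `|ξ(1)|` is comparable to `|z|² e^{Re z}`, that is
to `|k|π e^{√(|k|π)}`, which is the size of `hypScale k`.

Existence follows by perturbing the zeros of the limit functions (`exists_zero_of_near`). The lower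
bounds for large `|k|` come from `parabolic_lower_bound` and `hyperbolic_lower_bound`; for the
finitely many other indices it is enough that `ξ(1) ≠ 0`, which `observation_ne_zero` gives for
every nonzero eigenvalue. -/

/-! ### Vieta's formulas and independence of the labelling -/

lemma isCharRoots_iff {lam m₁ m₂ m₃ : ℂ} :
    IsCharRoots lam m₁ m₂ m₃ ↔ m₁ + m₂ + m₃ = lam ∧ m₁ * m₂ + m₁ * m₃ + m₂ * m₃ = -2 * lam ∧
      m₁ * m₂ * m₃ = -lam ^ 2 := by
  constructor
  · intro h
    have h0 := h 0
    have h1 := h 1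
    have h2 := h (-1)
    refine ⟨?_, ?_, ?_⟩
    · linear_combination (h1 + h2) / 2 - h0
    · linear_combination (h2 - h1) / 2
    · linear_combination h0
  · rintro ⟨h1, h2, h3⟩ m
    linear_combination m ^ 2 * h1 - m * h2 + h3

/-- The characteristic roots are unique up to a permutation. -/
lemma IsCharRoots.perm {lam m₁ m₂ m₃ n₁ n₂ n₃ : ℂ} (hm : IsCharRoots lam m₁ m₂ m₃)
    (hn : IsCharRoots lam n₁ n₂ n₃) :
    (n₁ = m₁ ∧ n₂ = m₂ ∧ n₃ = m₃) ∨ (n₁ = m₁ ∧ n₂ = m₃ ∧ n₃ = m₂) ∨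
    (n₁ = m₂ ∧ n₂ = m₁ ∧ n₃ = m₃) ∨ (n₁ = m₂ ∧ n₂ = m₃ ∧ n₃ = m₁) ∨
    (n₁ = m₃ ∧ n₂ = m₁ ∧ n₃ = m₂) ∨ (n₁ = m₃ ∧ n₂ = m₂ ∧ n₃ = m₁) := by
  have key : ∀ a b c d : ℂ, a + b = c + d → a * b = c * d → (a = c ∧ b = d) ∨ (a = d ∧ b = c) := by
    intro a b c d hs hp
    have : (a - c) * (a - d) = 0 := by linear_combination a * hs - hp
    rcases mul_eq_zero.1 this with h | h
    · have h' := sub_eq_zero.1 h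
      subst h'
      exact .inl ⟨rfl, by linear_combination hs⟩
    · have h' := sub_eq_zero.1 h
      subst h'
      exact .inr ⟨rfl, by linear_combination hs⟩
  have h : (n₁ - m₁) * (n₁ - m₂) * (n₁ - m₃) = 0 := by
    rw [← hm n₁, hn n₁]; ring
  obtain ⟨a1, a2, a3⟩ := isCharRoots_iff.1 hm
  obtain ⟨b1, b2, b3⟩ := isCharRoots_iff.1 hn
  rcases mul_eq_zero.1 h with h | h
  · rcases mul_eq_zero.1 h with h | h
    · have h' := sub_eq_zero.1 h
      subst h'
      have := key n₂ n₃ m₂ m₃ (by linear_combination b1 - a1)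
        (by linear_combination b2 - a2 - n₁ * (b1 - a1))
      rcases this with ⟨h, h'⟩ | ⟨h, h'⟩
      · exact .inl ⟨rfl, h, h'⟩
      · exact .inr (.inl ⟨rfl, h, h'⟩)
    · have h' := sub_eq_zero.1 h
      subst h'
      have := key n₂ n₃ m₁ m₃ (by linear_combination b1 - a1)
        (by linear_combination b2 - a2 - n₁ * (b1 - a1))
      rcases this with ⟨h, h'⟩ | ⟨h, h'⟩
      · exact .inr (.inr (.inl ⟨rfl, h, h'⟩))
      · exact .inr (.inr (.inr (.inl ⟨rfl, h, h'⟩)))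
  · have h' := sub_eq_zero.1 h
    subst h'
    have := key n₂ n₃ m₁ m₂ (by linear_combination b1 - a1)
      (by linear_combination b2 - a2 - n₁ * (b1 - a1))
    rcases this with ⟨h, h'⟩ | ⟨h, h'⟩
    · exact .inr (.inr (.inr (.inr (.inl ⟨rfl, h, h'⟩))))
    · exact .inr (.inr (.inr (.inr (.inr ⟨rfl, h, h'⟩))))

/-- The modulus of the reference function does not depend on the labelling of the roots. -/
lemma IsCharRoots.norm_xiFun_eq {lam m₁ m₂ m₃ n₁ n₂ n₃ : ℂ} (hm : IsCharRoots lam m₁ m₂ m₃)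
    (hn : IsCharRoots lam n₁ n₂ n₃) (x : ℝ) :
    ‖xiFun lam n₁ n₂ n₃ x‖ = ‖xiFun lam m₁ m₂ m₃ x‖ := by
  have : xiFun lam n₁ n₂ n₃ x = xiFun lam m₁ m₂ m₃ x ∨
      xiFun lam n₁ n₂ n₃ x = -xiFun lam m₁ m₂ m₃ x := by
    unfold xiFun
    rcases hm.perm hn with ⟨rfl, rfl, rfl⟩ | ⟨rfl, rfl, rfl⟩ | ⟨rfl, rfl, rfl⟩ | ⟨rfl, rfl, rfl⟩ |
      ⟨rfl, rfl, rfl⟩ | ⟨rfl, rfl, rfl⟩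
    · left; ring
    · right; ring
    · right; ring
    · left; ring
    · left; ring
    · right; ring
  rcases this with h | h
  · rw [h]
  · rw [h, norm_neg]

/-! ### Nonvanishing of the observation -/

/-- The numerator of `ξ(1)`. -/
def obsNum (m₁ m₂ m₃ : ℂ) : ℂ :=
  m₁ ^ 2 * (Complex.exp m₂ - Complex.exp m₃) * Complex.exp m₁ +
  m₂ ^ 2 * (Complex.exp m₃ - Complex.exp m₁) * Complex.exp m₂ +
  m₃ ^ 2 * (Complex.exp m₁ - Complex.exp m₂) * Complex.exp m₃

/-- The numerator of `ξ(1) - ξ(0)`: its zeros give the eigenvalues. -/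
def eigNum (m₁ m₂ m₃ : ℂ) : ℂ :=
  m₁ ^ 2 * (Complex.exp m₂ - Complex.exp m₃) * (Complex.exp m₁ - 1) +
  m₂ ^ 2 * (Complex.exp m₃ - Complex.exp m₁) * (Complex.exp m₂ - 1) +
  m₃ ^ 2 * (Complex.exp m₁ - Complex.exp m₂) * (Complex.exp m₃ - 1)

lemma xiFun_one {lam : ℂ} (hl : lam ≠ 0) (m₁ m₂ m₃ : ℂ) :
    xiFun lam m₁ m₂ m₃ 1 = -obsNum m₁ m₂ m₃ / lam := by
  unfold xiFun obsNum
  simp only [Complex.ofReal_one, mul_one]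
  field_simp
  ring

lemma xiFun_one_sub_zero {lam : ℂ} (hl : lam ≠ 0) (m₁ m₂ m₃ : ℂ) :
    xiFun lam m₁ m₂ m₃ 1 - xiFun lam m₁ m₂ m₃ 0 = -eigNum m₁ m₂ m₃ / lam := by
  unfold xiFun eigNum
  simp only [Complex.ofReal_one, mul_one, Complex.ofReal_zero, mul_zero, Complex.exp_zero]
  field_simp
  ring

/-- If `m₁ = -m₂`, the sum of the roots gives `m₃ = lam`, the second symmetric function gives `m₂² =
2 lam`, and the product then forces `2 lam² = lam²`. -/
lemma IsCharRoots.sq_ne_sq {lam m₁ m₂ m₃ : ℂ} (hl : lam ≠ 0) (h : IsCharRoots lam m₁ m₂ m₃)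
    (hne : m₁ ≠ m₂) : m₁ ^ 2 ≠ m₂ ^ 2 := by
  intro hsq
  obtain ⟨h1, h2, h3⟩ := isCharRoots_iff.1 h
  rcases sq_eq_sq_iff_eq_or_eq_neg.1 hsq with h' | h'
  · exact hne h'
  · subst h'
    have e1 : m₃ = lam := by linear_combination h1
    subst e1
    have e2 : m₂ ^ 2 = 2 * m₃ := by linear_combination -h2
    have : m₃ ^ 2 = 0 := by linear_combination -h3 - m₃ * e2
    exact hl (by simpa using this)

/-- A reference eigenfunction is observed: `ξ(1) ≠ 0`. -/
lemma observation_ne_zero {lam : ℂ} {Φ : State} (hl : lam ≠ 0) (he : IsEigenfunction lam Φ)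
    (hr : IsReference lam Φ) : observation Φ ≠ 0 := by
  intro h0
  obtain ⟨m₁, m₂, m₃, hm, rfl⟩ := hr
  obtain ⟨⟨_, _, _, _, _, _, _, h01, _, _, _, _⟩, x, _, hx⟩ := he
  simp only [observation] at h0 h01
  have hN : obsNum m₁ m₂ m₃ = 0 := by
    have := xiFun_one hl m₁ m₂ m₃
    rw [h0] at this
    field_simp at this
    linear_combination this
  have hD : eigNum m₁ m₂ m₃ = 0 := by
    have := xiFun_one_sub_zero hl m₁ m₂ m₃
    rw [h01] at this
    field_simp at this
    linear_combination this
  -- A double root would make both components of the reference pair vanish identically.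
  obtain ⟨h12, h23, h31⟩ : m₁ ≠ m₂ ∧ m₂ ≠ m₃ ∧ m₃ ≠ m₁ := by
    refine ⟨?_, ?_, ?_⟩ <;> rintro rfl <;> simp only [xiFun, etaFun] at hx <;>
      rcases hx with hx | hx <;> exact hx (by ring)
  have hm' := isCharRoots_iff.1 hm
  have q12 := hm.sq_ne_sq hl h12
  have q23 := IsCharRoots.sq_ne_sq hl (m₁ := m₂) (m₂ := m₃) (m₃ := m₁)
    (isCharRoots_iff.2 ⟨by linear_combination hm'.1, by linear_combination hm'.2.1,
      by linear_combination hm'.2.2⟩) h23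
  have q31 := IsCharRoots.sq_ne_sq hl (m₁ := m₃) (m₂ := m₁) (m₃ := m₂)
    (isCharRoots_iff.2 ⟨by linear_combination hm'.1, by linear_combination hm'.2.1,
      by linear_combination hm'.2.2⟩) h31
  simp only [xiFun, etaFun] at hx
  unfold obsNum at hN
  unfold eigNum at hD
  set E₁ := Complex.exp m₁
  set E₂ := Complex.exp m₂
  set E₃ := Complex.exp m₃
  -- `obsNum` and `obsNum - eigNum` are two linear relations between the squares of the roots;
  -- eliminating one square leaves a difference of squares times a product of two differences of
  -- exponentials. The three differences sum to zero and have pairwise zero products, so each of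
  -- them vanishes.
  have p1 : (E₁ - E₂) * (E₂ - E₃) = 0 := by
    have : (m₃ ^ 2 - m₁ ^ 2) * ((E₁ - E₂) * (E₂ - E₃)) = 0 := by
      linear_combination E₂ * (hN - hD) - hN
    exact (mul_eq_zero.1 this).resolve_left (sub_ne_zero.2 q31)
  have p2 : (E₂ - E₃) * (E₃ - E₁) = 0 := by
    have : (m₁ ^ 2 - m₂ ^ 2) * ((E₂ - E₃) * (E₃ - E₁)) = 0 := by
      linear_combination E₃ * (hN - hD) - hN
    exact (mul_eq_zero.1 this).resolve_left (sub_ne_zero.2 q12)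
  have p3 : (E₃ - E₁) * (E₁ - E₂) = 0 := by
    have : (m₂ ^ 2 - m₃ ^ 2) * ((E₃ - E₁) * (E₁ - E₂)) = 0 := by
      linear_combination E₁ * (hN - hD) - hN
    exact (mul_eq_zero.1 this).resolve_left (sub_ne_zero.2 q23)
  have s1 : E₂ - E₃ = 0 := by
    have : (E₂ - E₃) ^ 2 = 0 := by linear_combination -p1 - p2
    simpa using this
  have s2 : E₃ - E₁ = 0 := by
    have : (E₃ - E₁) ^ 2 = 0 := by linear_combination -p2 - p3
    simpa using this
  have s3 : E₁ - E₂ = 0 := by linear_combination -s1 - s2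
  rw [s1, s2, s3] at hx
  simp at hx

/-! ### A parametrization of the characteristic roots -/

/-- The small correction in the parametrization of the characteristic roots. -/
def rootCorr (z : ℂ) : ℂ :=
  2 / ((z - 1 / 2) * (1 + (1 - 4 / ((z - 1 / 2) * (z + 1 / 2) ^ 2)) ^ (((2 : ℕ) : ℂ)⁻¹)))

/-- The root close to `z²`. -/
def rootA (z : ℂ) : ℂ := z ^ 2 - 1 / 4 - rootCorr z

/-- The root close to `z`. -/
def rootB (z : ℂ) : ℂ := z - 1 / 2 - 1 / (z - 1 / 2)

/-- The root close to `-z`. -/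
def rootC (z : ℂ) : ℂ := -z - 1 / 2 + rootCorr z

/-- The spectral parameter as a function of the uniformizing variable. -/
def specParam (z : ℂ) : ℂ := z ^ 2 - 5 / 4 - 1 / (z - 1 / 2)

/-- Given `rootB z`, the sum of the roots lets the other two be written `z² - 1/4 - e` and `-z - 1/2
+ e`; this quadratic for `e` is what remains of the cubic. `rootCorr` is its small solution, with
the square root moved to the denominator so that no cancellation occurs at infinity. -/
lemma rootCorr_quadratic {z : ℂ} (h1 : z - 1 / 2 ≠ 0) (h2 : z + 1 / 2 ≠ 0) :
    rootCorr z ^ 2 - (z + 1 / 2) ^ 2 * rootCorr z + (z + 1 / 2) ^ 2 / (z - 1 / 2) = 0 := by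
  unfold rootCorr
  set t := z - 1 / 2 with ht
  set v := z + 1 / 2 with hv
  set s := (1 - 4 / (t * v ^ 2)) ^ (((2 : ℕ) : ℂ)⁻¹) with hs
  have hs2 : s ^ 2 = 1 - 4 / (t * v ^ 2) := Complex.cpow_nat_inv_pow _ two_ne_zero
  have hs1 : 1 + s ≠ 0 := by
    intro h
    have : s = -1 := by linear_combination h
    rw [this] at hs2
    have h4 : 4 / (t * v ^ 2) = 0 := by linear_combination hs2
    have : t * v ^ 2 ≠ 0 := by positivity
    simp_all
  field_simp at hs2 ⊢
  linear_combination hs2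

lemma isCharRoots_param {z : ℂ} (h1 : z - 1 / 2 ≠ 0) (h2 : z + 1 / 2 ≠ 0) :
    IsCharRoots (specParam z) (rootA z) (rootB z) (rootC z) := by
  have hq := rootCorr_quadratic h1 h2
  rw [isCharRoots_iff]
  unfold specParam rootA rootB rootC
  generalize rootCorr z = e at *
  obtain ⟨t, rfl⟩ : ∃ t, z = t + 1 / 2 := ⟨z - 1 / 2, by ring⟩
  have e1 : t + 1 / 2 - 1 / 2 = t := by ring
  have e2 : t + 1 / 2 + 1 / 2 = t + 1 := by ring
  rw [e1] at h1 hq ⊢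
  rw [e2] at h2 hq
  refine ⟨by ring, ?_, ?_⟩
  · field_simp at hq ⊢
    linear_combination -32 * hq
  · field_simp at hq ⊢
    linear_combination 256 * (1 - t ^ 2) * hq

open Filter Topology Asymptotics Bornology

/-! ### Asymptotics of the characteristic roots -/

lemma tendsto_mul_zero_of_isBigO_one {α : Type*} {l : Filter α} {f g : α → ℂ}
    (hf : Tendsto f l (𝓝 0)) (hg : g =O[l] (fun _ => (1 : ℂ))) :
    Tendsto (fun x => f x * g x) l (𝓝 0) := by
  have h := ((isLittleO_one_iff ℂ).2 hf).mul_isBigO hg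
  simp only [mul_one] at h
  exact (isLittleO_one_iff ℂ).1 h

lemma tendsto_inv_add_cobounded (a : ℂ) :
    Tendsto (fun z : ℂ => (z + a)⁻¹) (cobounded ℂ) (𝓝 0) :=
  tendsto_inv₀_cobounded.comp (tendsto_add_const_cobounded a)

lemma tendsto_inv_sub_half : Tendsto (fun z : ℂ => 1 / (z - 1 / 2)) (cobounded ℂ) (𝓝 0) := by
  simpa [sub_eq_add_neg] using tendsto_inv_add_cobounded (-(1 / 2))

lemma tendsto_radicand :
    Tendsto (fun z : ℂ => 1 - 4 / ((z - 1 / 2) * (z + 1 / 2) ^ 2)) (cobounded ℂ) (𝓝 1) := by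
  have h := (tendsto_inv_add_cobounded (-(1 / 2))).mul ((tendsto_inv_add_cobounded (1 / 2)).pow 2)
  have h' := (h.const_mul 4).const_sub 1
  simp only [zero_mul, mul_zero, sub_zero] at h'
  refine h'.congr fun z => ?_
  rw [div_eq_mul_inv 4, mul_inv, inv_pow, sub_eq_add_neg z]

lemma tendsto_rootCorr : Tendsto rootCorr (cobounded ℂ) (𝓝 0) := by
  have h1 : Tendsto (fun z : ℂ =>
      (1 - 4 / ((z - 1 / 2) * (z + 1 / 2) ^ 2)) ^ (((2 : ℕ) : ℂ)⁻¹)) (cobounded ℂ) (𝓝 1) := by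
    have := tendsto_radicand.cpow (tendsto_const_nhds (x := ((2 : ℕ) : ℂ)⁻¹))
      (by simp [Complex.slitPlane])
    simpa using this
  have h2 := (h1.const_add 1).inv₀ (by norm_num)
  have h3 := (tendsto_inv_sub_half.const_mul 2).mul h2
  simp only [mul_zero, zero_mul] at h3
  refine h3.congr fun z => ?_
  unfold rootCorr
  rw [div_eq_mul_inv 2, mul_inv, one_div, mul_assoc]

/-- The radicand tends to `1`, hence stays away from the branch cut. -/
lemma eventually_differentiableAt_rootCorr :
    ∀ᶠ z in cobounded ℂ, DifferentiableAt ℂ rootCorr z := by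
  have h1 : Tendsto (fun z : ℂ =>
      (1 - 4 / ((z - 1 / 2) * (z + 1 / 2) ^ 2)) ^ (((2 : ℕ) : ℂ)⁻¹)) (cobounded ℂ) (𝓝 1) := by
    have := tendsto_radicand.cpow (tendsto_const_nhds (x := ((2 : ℕ) : ℂ)⁻¹))
      (by simp [Complex.slitPlane])
    simpa using this
  have h2 := (h1.const_add 1).eventually (isOpen_ne.mem_nhds (by norm_num : (1 + 1 : ℂ) ≠ 0))
  have h3 : ∀ᶠ z : ℂ in cobounded ℂ,
      1 - 4 / ((z - 1 / 2) * (z + 1 / 2) ^ 2) ∈ Complex.slitPlane :=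
    tendsto_radicand.eventually (Complex.isOpen_slitPlane.mem_nhds (by simp [Complex.slitPlane]))
  filter_upwards [h2, h3, eventually_ne_cobounded (1 / 2 : ℂ), eventually_ne_cobounded (-1 / 2 : ℂ)]
    with z h2 h3 h4 h5
  have h4' : z - 1 / 2 ≠ 0 := sub_ne_zero.2 h4
  have h5' : z + 1 / 2 ≠ 0 := fun h => h5 (by linear_combination h)
  have h6 : DifferentiableAt ℂ (fun z : ℂ => 1 - 4 / ((z - 1 / 2) * (z + 1 / 2) ^ 2)) z := by
    fun_prop (disch := positivity)
  have h7 : DifferentiableAt ℂ (fun z : ℂ =>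
      (1 - 4 / ((z - 1 / 2) * (z + 1 / 2) ^ 2)) ^ (((2 : ℕ) : ℂ)⁻¹)) z :=
    h6.cpow_const h3
  exact (differentiableAt_const _).div
    (((differentiableAt_id.sub_const _)).mul (h7.const_add 1)) (mul_ne_zero h4' h2)

lemma tendsto_inv_sq_cobounded : Tendsto (fun z : ℂ => (z⁻¹) ^ 2) (cobounded ℂ) (𝓝 0) := by
  simpa using (tendsto_inv₀_cobounded (α := ℂ)).pow 2

lemma tendsto_rootA_div : Tendsto (fun z => rootA z / z ^ 2) (cobounded ℂ) (𝓝 1) := by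
  have h := ((tendsto_rootCorr.const_add (1 / 4)).mul tendsto_inv_sq_cobounded).const_sub 1
  simp only [mul_zero, sub_zero] at h
  refine h.congr' ?_
  filter_upwards [eventually_ne_cobounded (0 : ℂ)] with z hz
  unfold rootA
  field_simp
  ring

lemma tendsto_specParam_div : Tendsto (fun z => specParam z / z ^ 2) (cobounded ℂ) (𝓝 1) := by
  have h := ((tendsto_inv_sub_half.const_add (5 / 4)).mul tendsto_inv_sq_cobounded).const_sub 1
  simp only [mul_zero, sub_zero] at h
  refine h.congr' ?_
  filter_upwards [eventually_ne_cobounded (0 : ℂ)] with z hz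
  unfold specParam
  generalize 1 / (z - 1 / 2) = y
  field_simp
  ring

lemma tendsto_rootB_div : Tendsto (fun z => rootB z / z ^ 2) (cobounded ℂ) (𝓝 0) := by
  have h := (tendsto_inv₀_cobounded (α := ℂ)).sub
    ((tendsto_inv_sub_half.const_add (1 / 2)).mul tendsto_inv_sq_cobounded)
  simp only [mul_zero, sub_zero] at h
  refine h.congr' ?_
  filter_upwards [eventually_ne_cobounded (0 : ℂ)] with z hz
  unfold rootB
  generalize 1 / (z - 1 / 2) = y
  field_simp
  ring

lemma tendsto_rootC_div : Tendsto (fun z => rootC z / z ^ 2) (cobounded ℂ) (𝓝 0) := by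
  have h := ((tendsto_rootCorr.sub_const (1 / 2)).mul tendsto_inv_sq_cobounded).sub
    (tendsto_inv₀_cobounded (α := ℂ))
  simp only [mul_zero, sub_zero] at h
  refine h.congr' ?_
  filter_upwards [eventually_ne_cobounded (0 : ℂ)] with z hz
  unfold rootC
  field_simp
  ring

/-- Large `z` in a vertical strip. -/
def stripFilter : Filter ℂ := cobounded ℂ ⊓ 𝓟 {z | |z.re| ≤ 4}

/-- Large `z` in the right half plane, with `z²` in a vertical strip. -/
def sqStripFilter : Filter ℂ := cobounded ℂ ⊓ 𝓟 {z | |(z ^ 2).re| ≤ 8 ∧ 0 ≤ z.re}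

lemma stripFilter_le : stripFilter ≤ cobounded ℂ := inf_le_left

lemma sqStripFilter_le : sqStripFilter ≤ cobounded ℂ := inf_le_left

lemma eventually_stripFilter : ∀ᶠ z in stripFilter, |z.re| ≤ 4 :=
  mem_inf_of_right (mem_principal_self _)

lemma eventually_sqStripFilter : ∀ᶠ z in sqStripFilter, |(z ^ 2).re| ≤ 8 ∧ 0 ≤ z.re :=
  mem_inf_of_right (mem_principal_self _)

lemma isBigO_one_exp {l : Filter ℂ} {f : ℂ → ℂ} (c : ℝ) (h : ∀ᶠ z in l, (f z).re ≤ c) :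
    (fun z => Complex.exp (f z)) =O[l] (fun _ => (1 : ℂ)) := by
  refine IsBigO.of_bound (Real.exp c) ?_
  filter_upwards [h] with z hz
  simpa [Complex.norm_exp] using hz

lemma tendsto_exp_add_sub {l : Filter ℂ} {f g : ℂ → ℂ}
    (hf : (fun z => Complex.exp (f z)) =O[l] (fun _ => (1 : ℂ))) (hg : Tendsto g l (𝓝 0)) :
    Tendsto (fun z => Complex.exp (f z + g z) - Complex.exp (f z)) l (𝓝 0) := by
  have h : Tendsto (fun z => Complex.exp (g z) - 1) l (𝓝 0) := by
    simpa using (((Complex.continuous_exp.tendsto 0).comp hg).sub_const 1)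
  refine (tendsto_mul_zero_of_isBigO_one h hf).congr fun z => ?_
  rw [Complex.exp_add]; ring

lemma isBigO_one_exp_add {l : Filter ℂ} {f g : ℂ → ℂ}
    (hf : (fun z => Complex.exp (f z)) =O[l] (fun _ => (1 : ℂ))) (hg : Tendsto g l (𝓝 0)) :
    (fun z => Complex.exp (f z + g z)) =O[l] (fun _ => (1 : ℂ)) := by
  have := ((tendsto_exp_add_sub hf hg).isBigO_one ℂ).add hf
  simpa using this

/-! #### In a vertical strip -/

lemma isBigO_strip_expB : (fun z => Complex.exp (z - 1 / 2)) =O[stripFilter] (fun _ => (1 : ℂ)) := by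
  refine isBigO_one_exp 4 ?_
  filter_upwards [eventually_stripFilter] with z hz
  have := (abs_le.1 hz).2
  simp
  linarith

lemma isBigO_strip_expC : (fun z => Complex.exp (-z - 1 / 2)) =O[stripFilter] (fun _ => (1 : ℂ)) := by
  refine isBigO_one_exp 4 ?_
  filter_upwards [eventually_stripFilter] with z hz
  have := (abs_le.1 hz).1
  simp
  linarith

lemma rootB_eq (z : ℂ) : rootB z = (z - 1 / 2) + -(1 / (z - 1 / 2)) := by
  unfold rootB; ring

lemma tendsto_neg_inv_sub_half :
    Tendsto (fun z : ℂ => -(1 / (z - 1 / 2))) (cobounded ℂ) (𝓝 0) := by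
  simpa using tendsto_inv_sub_half.neg

/-- Since `Re z² = 2 (Re z)² - |z|²`, the real part of `A` goes to `-∞` like `-|z|²`. -/
lemma tendsto_strip_pow_mul_expA (n : ℕ) :
    Tendsto (fun z => z ^ n * Complex.exp (rootA z)) stripFilter (𝓝 0) := by
  have h1 : Tendsto (fun z : ℂ => ‖z‖) stripFilter atTop :=
    tendsto_norm_cobounded_atTop.mono_left stripFilter_le
  -- Here `Re A ≤ 2 · 4² - ‖z‖² - 1/4 + 1 ≤ 33 - ‖z‖` as soon as `‖z‖ ≥ 1`.
  have h2 := ((Real.tendsto_pow_mul_exp_neg_atTop_nhds_zero n).comp h1).const_mul (Real.exp 33)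
  rw [mul_zero] at h2
  refine squeeze_zero_norm' ?_ h2
  have h3 : ∀ᶠ z in stripFilter, ‖rootCorr z‖ < 1 := by
    have := (tendsto_rootCorr.mono_left stripFilter_le).norm
    rw [norm_zero] at this
    exact this.eventually_lt_const one_pos
  filter_upwards [eventually_stripFilter, h3, h1.eventually_ge_atTop 1] with z hz h3 h4
  rw [norm_mul, norm_pow, Complex.norm_exp]
  simp only [Function.comp]
  rw [mul_left_comm, ← Real.exp_add]
  gcongr
  have h5 := (abs_le.1 ((Complex.abs_re_le_norm (rootCorr z)).trans h3.le)).1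
  have h6 : (z ^ 2).re = 2 * z.re ^ 2 - ‖z‖ ^ 2 := by
    rw [Complex.sq_norm, Complex.normSq_apply, sq, Complex.mul_re]; ring
  have h7 : z.re ^ 2 ≤ 4 ^ 2 := sq_le_sq' (abs_le.1 hz).1 (abs_le.1 hz).2
  have h8 : (rootA z).re = (z ^ 2).re - 1 / 4 - (rootCorr z).re := by
    simp [rootA]
  rw [h8, h6]
  nlinarith

/-- Only the term with `A² ≈ z⁴` survives division by `z⁴`, since `B²` and `C²` are `o(z⁴)` and all
exponentials are bounded; there `e^A - 1` tends to `-1`. -/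
lemma tendsto_strip_eigNum :
    Tendsto (fun z => eigNum (rootA z) (rootB z) (rootC z) / z ^ 4 +
      (Complex.exp (z - 1 / 2) - Complex.exp (-z - 1 / 2))) stripFilter (𝓝 0) := by
  have hle := stripFilter_le
  have a := (tendsto_rootA_div.mono_left hle).pow 2
  have b := (tendsto_rootB_div.mono_left hle).pow 2
  have c := (tendsto_rootC_div.mono_left hle).pow 2
  have e1 : Tendsto (fun z => Complex.exp (rootA z)) stripFilter (𝓝 0) := by
    simpa using tendsto_strip_pow_mul_expA 0
  have d2 : Tendsto (fun z => Complex.exp (rootB z) - Complex.exp (z - 1 / 2)) stripFilter (𝓝 0) := by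
    simp only [rootB_eq]
    exact tendsto_exp_add_sub isBigO_strip_expB (tendsto_neg_inv_sub_half.mono_left hle)
  have d3 : Tendsto (fun z => Complex.exp (rootC z) - Complex.exp (-z - 1 / 2)) stripFilter (𝓝 0) :=
    tendsto_exp_add_sub isBigO_strip_expC (tendsto_rootCorr.mono_left hle)
  have e2 : (fun z => Complex.exp (rootB z)) =O[stripFilter] (fun _ => (1 : ℂ)) := by
    simpa using (d2.isBigO_one ℂ).add isBigO_strip_expB
  have e3 : (fun z => Complex.exp (rootC z)) =O[stripFilter] (fun _ => (1 : ℂ)) := by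
    simpa using (d3.isBigO_one ℂ).add isBigO_strip_expC
  have one : (fun _ : ℂ => (1 : ℂ)) =O[stripFilter] (fun _ => (1 : ℂ)) := isBigO_refl _ _
  have t1 : Tendsto (fun z => (rootA z / z ^ 2) ^ 2 * (Complex.exp (rootA z) - 1) + 1)
      stripFilter (𝓝 0) := by
    simpa using (a.mul (e1.sub_const 1)).add_const 1
  have t1' := tendsto_mul_zero_of_isBigO_one t1 (e2.sub e3)
  simp only [one_pow, zero_pow two_ne_zero] at a b c
  have p2 : (fun z => (Complex.exp (rootC z) - Complex.exp (rootA z)) * (Complex.exp (rootB z) - 1))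
      =O[stripFilter] (fun _ => (1 : ℂ)) := by
    simpa using (e3.sub (e1.isBigO_one ℂ)).mul (e2.sub one)
  have p3 : (fun z => (Complex.exp (rootA z) - Complex.exp (rootB z)) * (Complex.exp (rootC z) - 1))
      =O[stripFilter] (fun _ => (1 : ℂ)) := by
    simpa using ((e1.isBigO_one ℂ).sub e2).mul (e3.sub one)
  have tot := (((t1'.sub (d2.sub d3)).add (tendsto_mul_zero_of_isBigO_one b p2)).add
    (tendsto_mul_zero_of_isBigO_one c p3))
  simp only [sub_zero, add_zero] at tot
  refine tot.congr' ?_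
  filter_upwards [hle (eventually_ne_cobounded (0 : ℂ))] with z hz
  unfold eigNum
  field_simp
  ring

/-- Every term with a factor `e^A` is negligible, which leaves `(B² - C²) e^{B + C}`. Here `B + C`
tends to `-1` and `B - C` is asymptotic to `2z`. -/
lemma tendsto_strip_obsNum :
    Tendsto (fun z => obsNum (rootA z) (rootB z) (rootC z) / z) stripFilter
      (𝓝 (-2 * Complex.exp (-1))) := by
  have hle := stripFilter_le
  have a := ((tendsto_rootA_div.mono_left hle).pow 2).isBigO_one ℂ
  have b := ((tendsto_rootB_div.mono_left hle).pow 2).isBigO_one ℂ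
  have c := ((tendsto_rootC_div.mono_left hle).pow 2).isBigO_one ℂ
  have hi := tendsto_neg_inv_sub_half.mono_left hle
  have hc := tendsto_rootCorr.mono_left hle
  have e2 : (fun z => Complex.exp (rootB z)) =O[stripFilter] (fun _ => (1 : ℂ)) := by
    simp only [rootB_eq]
    exact isBigO_one_exp_add isBigO_strip_expB hi
  have e3 : (fun z => Complex.exp (rootC z)) =O[stripFilter] (fun _ => (1 : ℂ)) :=
    isBigO_one_exp_add isBigO_strip_expC hc
  have p : (fun z => (rootA z / z ^ 2) ^ 2 * (Complex.exp (rootB z) - Complex.exp (rootC z)) -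
      (rootB z / z ^ 2) ^ 2 * Complex.exp (rootB z) +
      (rootC z / z ^ 2) ^ 2 * Complex.exp (rootC z)) =O[stripFilter] (fun _ => (1 : ℂ)) := by
    simpa using ((a.mul (e2.sub e3)).sub (b.mul e2)).add (c.mul e3)
  have t1 := tendsto_mul_zero_of_isBigO_one (tendsto_strip_pow_mul_expA 3) p
  have hs : Tendsto (fun z => -1 + (-(1 / (z - 1 / 2)) + rootCorr z)) stripFilter (𝓝 (-1)) := by
    simpa using (hi.add hc).const_add (-1)
  have t2 := (Complex.continuous_exp.tendsto _).comp hs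
  have t3 : Tendsto (fun z => 2 + (-(1 / (z - 1 / 2)) - rootCorr z) * z⁻¹) stripFilter (𝓝 2) := by
    simpa using ((hi.sub hc).mul (tendsto_inv₀_cobounded.mono_left hle)).const_add 2
  have tot := t1.add ((t3.mul hs).mul t2)
  have : (0 : ℂ) + 2 * -1 * Complex.exp (-1) = -2 * Complex.exp (-1) := by ring
  rw [this] at tot
  refine tot.congr' ?_
  filter_upwards [hle (eventually_ne_cobounded (0 : ℂ))] with z hz
  have h1 : Complex.exp (-1 + (-(1 / (z - 1 / 2)) + rootCorr z)) =
      Complex.exp (rootB z) * Complex.exp (rootC z) := by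
    rw [← Complex.exp_add]; congr 1; unfold rootB rootC; ring
  have h2 : (2 + (-(1 / (z - 1 / 2)) - rootCorr z) * z⁻¹) *
      (-1 + (-(1 / (z - 1 / 2)) + rootCorr z)) = (rootB z ^ 2 - rootC z ^ 2) / z := by
    unfold rootB rootC
    generalize 1 / (z - 1 / 2) = y
    field_simp
    ring
  rw [h2]
  simp only [Function.comp]
  rw [h1]
  unfold obsNum
  field_simp
  ring

/-! #### With the square in a vertical strip -/

/-- `2 (Re z)² = |z|² + Re z²`, and the last term is bounded. -/
lemma tendsto_sqStrip_re : Tendsto Complex.re sqStripFilter atTop := by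
  have h1 : Tendsto (fun z : ℂ => ‖z‖) sqStripFilter atTop :=
    tendsto_norm_cobounded_atTop.mono_left sqStripFilter_le
  refine tendsto_atTop.2 fun b => ?_
  filter_upwards [eventually_sqStripFilter, h1.eventually_ge_atTop (2 * |b| + 8)] with z hz h2
  have h6 : (z ^ 2).re = 2 * z.re ^ 2 - ‖z‖ ^ 2 := by
    rw [Complex.sq_norm, Complex.normSq_apply, sq, Complex.mul_re]; ring
  have h7 := (abs_le.1 hz.1).1
  have h8 : |b| ^ 2 ≤ z.re ^ 2 := by nlinarith [abs_nonneg b]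
  exact (le_abs_self b).trans ((pow_le_pow_iff_left₀ (abs_nonneg b) hz.2 two_ne_zero).1 h8)


lemma sqStrip_sq_sub_le : ∀ᶠ z : ℂ in sqStripFilter, (z ^ 2 - 1 / 4).re ≤ 8 := by
  filter_upwards [eventually_sqStripFilter] with z hz
  have := (abs_le.1 hz.1).2
  rw [Complex.sub_re]
  norm_num
  linarith

lemma isBigO_sqStrip_exp_sq :
    (fun z : ℂ => Complex.exp (z ^ 2 - 1 / 4)) =O[sqStripFilter] (fun _ => (1 : ℂ)) :=
  isBigO_one_exp 8 sqStrip_sq_sub_le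

lemma isBigO_sqStrip_exp_neg_sq :
    (fun z : ℂ => Complex.exp (-(z ^ 2 - 1 / 4))) =O[sqStripFilter] (fun _ => (1 : ℂ)) := by
  refine isBigO_one_exp 9 ?_
  filter_upwards [eventually_sqStripFilter] with z hz
  have := (abs_le.1 hz.1).1
  rw [Complex.neg_re, Complex.sub_re]
  norm_num
  linarith

lemma tendsto_sqStrip_expA_sub :
    Tendsto (fun z => Complex.exp (rootA z) - Complex.exp (z ^ 2 - 1 / 4)) sqStripFilter (𝓝 0) := by
  have := tendsto_exp_add_sub isBigO_sqStrip_exp_sq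
    (by simpa using (tendsto_rootCorr.mono_left sqStripFilter_le).neg)
  exact this.congr fun z => by simp [rootA, sub_eq_add_neg]

lemma isBigO_sqStrip_expA :
    (fun z => Complex.exp (rootA z)) =O[sqStripFilter] (fun _ => (1 : ℂ)) := by
  simpa using (tendsto_sqStrip_expA_sub.isBigO_one ℂ).add isBigO_sqStrip_exp_sq

lemma isBigO_sqStrip_exp_neg_A :
    (fun z => Complex.exp (-rootA z)) =O[sqStripFilter] (fun _ => (1 : ℂ)) := by
  have := isBigO_one_exp_add isBigO_sqStrip_exp_neg_sq (tendsto_rootCorr.mono_left sqStripFilter_le)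
  refine this.congr_left fun z => ?_
  congr 1; unfold rootA; ring

lemma tendsto_exp_zero {l : Filter ℂ} {f : ℂ → ℂ} {g : ℂ → ℂ}
    (hf : Tendsto (fun z => (f z).re) l atBot) (hg : Tendsto g l (𝓝 0)) :
    Tendsto (fun z => Complex.exp (f z + g z)) l (𝓝 0) := by
  have h1 : Tendsto (fun z => Complex.exp (f z)) l (𝓝 0) := by
    rw [tendsto_zero_iff_norm_tendsto_zero]
    simp only [Complex.norm_exp]
    exact Real.tendsto_exp_atBot.comp hf
  have h2 := h1.mul ((Complex.continuous_exp.tendsto 0).comp hg)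
  rw [zero_mul] at h2
  exact h2.congr fun z => by simp [Complex.exp_add]

lemma tendsto_sqStrip_exp_neg_B :
    Tendsto (fun z => Complex.exp (-rootB z)) sqStripFilter (𝓝 0) := by
  have h1 : Tendsto (fun z : ℂ => (-z).re) sqStripFilter atBot := 
    tendsto_neg_atTop_atBot.comp tendsto_sqStrip_re
  have h2 : Tendsto (fun z : ℂ => -z + 1 / 2 |>.re) sqStripFilter atBot := by
    simpa using tendsto_atBot_add_const_right _ (1 / 2 : ℝ) h1
  refine (tendsto_exp_zero h2 (tendsto_inv_sub_half.mono_left sqStripFilter_le)).congr fun z => ?_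
  congr 1; unfold rootB; ring

lemma tendsto_sqStrip_expC :
    Tendsto (fun z => Complex.exp (rootC z)) sqStripFilter (𝓝 0) := by
  have h1 : Tendsto (fun z : ℂ => (-z).re) sqStripFilter atBot := 
    tendsto_neg_atTop_atBot.comp tendsto_sqStrip_re
  have h2 : Tendsto (fun z : ℂ => -z - 1 / 2 |>.re) sqStripFilter atBot := by
    simpa [sub_eq_add_neg] using tendsto_atBot_add_const_right _ (-(2 : ℝ)⁻¹) h1
  exact tendsto_exp_zero h2 (tendsto_rootCorr.mono_left sqStripFilter_le)

/-- After division by `z⁴ e^B` the term `A² e^B (e^A - 1)` dominates: `e^C` and `e^{-B}` tend to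
`0`, and `B²`, `C²` are of lower order. -/
lemma tendsto_sqStrip_eigNum :
    Tendsto (fun z => eigNum (rootA z) (rootB z) (rootC z) / z ^ 4 * Complex.exp (-rootB z) -
      (Complex.exp (z ^ 2 - 1 / 4) - 1)) sqStripFilter (𝓝 0) := by
  have hle := sqStripFilter_le
  have a := (tendsto_rootA_div.mono_left hle).pow 2
  have b := (tendsto_rootB_div.mono_left hle).pow 2
  have c := (tendsto_rootC_div.mono_left hle).pow 2
  simp only [one_pow, zero_pow two_ne_zero] at a b c
  have e1 := isBigO_sqStrip_expA
  have n2 := tendsto_sqStrip_exp_neg_B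
  have e3 := tendsto_sqStrip_expC
  have one : (fun _ : ℂ => (1 : ℂ)) =O[sqStripFilter] (fun _ => (1 : ℂ)) := isBigO_refl _ _
  have t1 : Tendsto (fun z => (rootA z / z ^ 2) ^ 2 *
      (1 - Complex.exp (rootC z) * Complex.exp (-rootB z)) - 1) sqStripFilter (𝓝 0) := by
    simpa using (a.mul ((e3.mul n2).const_sub 1)).sub_const 1
  have t1' := tendsto_mul_zero_of_isBigO_one t1 (e1.sub one)
  have p2 : (fun z => (Complex.exp (rootC z) - Complex.exp (rootA z)) *
      (1 - Complex.exp (-rootB z))) =O[sqStripFilter] (fun _ => (1 : ℂ)) := by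
    simpa using ((e3.isBigO_one ℂ).sub e1).mul (one.sub (n2.isBigO_one ℂ))
  have p3 : (fun z => (Complex.exp (rootA z) * Complex.exp (-rootB z) - 1) *
      (Complex.exp (rootC z) - 1)) =O[sqStripFilter] (fun _ => (1 : ℂ)) := by
    have h := e1.mul (n2.isBigO_one ℂ)
    simp only [mul_one] at h
    simpa using (h.sub one).mul ((e3.isBigO_one ℂ).sub one)
  have tot := ((t1'.add tendsto_sqStrip_expA_sub).add (tendsto_mul_zero_of_isBigO_one b p2)).add
    (tendsto_mul_zero_of_isBigO_one c p3)
  simp only [add_zero] at tot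
  refine tot.congr' ?_
  filter_upwards [hle (eventually_ne_cobounded (0 : ℂ))] with z hz
  unfold eigNum
  rw [Complex.exp_neg]
  have := Complex.exp_ne_zero (rootB z)
  field_simp
  ring

lemma tendsto_sqStrip_obsNum :
    Tendsto (fun z => obsNum (rootA z) (rootB z) (rootC z) / z ^ 4 *
      (Complex.exp (-rootA z) * Complex.exp (-rootB z))) sqStripFilter (𝓝 1) := by
  have hle := sqStripFilter_le
  have a := (tendsto_rootA_div.mono_left hle).pow 2
  have b := (tendsto_rootB_div.mono_left hle).pow 2
  have c := (tendsto_rootC_div.mono_left hle).pow 2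
  simp only [one_pow, zero_pow two_ne_zero] at a b c
  have n1 := isBigO_sqStrip_exp_neg_A
  have n2 := tendsto_sqStrip_exp_neg_B
  have e3 := tendsto_sqStrip_expC
  have one : (fun _ : ℂ => (1 : ℂ)) =O[sqStripFilter] (fun _ => (1 : ℂ)) := isBigO_refl _ _
  have t1 : Tendsto (fun z => (rootA z / z ^ 2) ^ 2 *
      (1 - Complex.exp (rootC z) * Complex.exp (-rootB z))) sqStripFilter (𝓝 1) := by
    simpa using a.mul ((e3.mul n2).const_sub 1)
  have p2 : (fun z => Complex.exp (rootC z) * Complex.exp (-rootA z) - 1)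
      =O[sqStripFilter] (fun _ => (1 : ℂ)) := by
    have h := (e3.isBigO_one ℂ).mul n1
    simp only [mul_one] at h
    exact h.sub one
  have p3 : (fun z => (Complex.exp (-rootB z) - Complex.exp (-rootA z)) *
      Complex.exp (rootC z)) =O[sqStripFilter] (fun _ => (1 : ℂ)) := by
    simpa using ((n2.isBigO_one ℂ).sub n1).mul (e3.isBigO_one ℂ)
  have tot := (t1.add (tendsto_mul_zero_of_isBigO_one b p2)).add
    (tendsto_mul_zero_of_isBigO_one c p3)
  simp only [add_zero] at tot
  refine tot.congr' ?_
  filter_upwards [hle (eventually_ne_cobounded (0 : ℂ))] with z hz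
  unfold obsNum
  rw [Complex.exp_neg, Complex.exp_neg]
  have := Complex.exp_ne_zero (rootB z)
  have := Complex.exp_ne_zero (rootA z)
  field_simp

/-! ### Eigenfunctions -/

lemma HasL2Deriv.of_hasDerivAt {f g : ℝ → ℂ} (h : ∀ x, HasDerivAt f (g x) x) (hg : Continuous g) :
    HasL2Deriv f g := by
  refine ⟨?_, fun x _ => ?_⟩
  · obtain ⟨C, hC⟩ := isCompact_Icc.exists_bound_of_continuousOn (hg.continuousOn (s := Icc 0 1))
    exact MemLp.of_bound hg.aestronglyMeasurable C
      ((ae_restrict_iff' measurableSet_Icc).2 (.of_forall hC))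
  · rw [intervalIntegral.integral_eq_sub_of_hasDerivAt (fun y _ => h y)
      (hg.intervalIntegrable _ _)]
    ring

/-- A linear combination of three exponentials. -/
def expSum (m a : Fin 3 → ℂ) (x : ℝ) : ℂ := ∑ j, a j * Complex.exp (m j * x)

lemma expSum_hasDerivAt (m a : Fin 3 → ℂ) (x : ℝ) :
    HasDerivAt (expSum m a) (expSum m (fun j => a j * m j) x) x := by
  unfold expSum
  refine HasDerivAt.fun_sum fun j _ => ?_
  have h : HasDerivAt (fun x : ℝ => m j * (x : ℂ)) (m j * 1) x :=
    (HasDerivAt.ofReal_comp (hasDerivAt_id x)).const_mul _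
  refine (h.cexp.const_mul (a j)).congr_deriv ?_
  ring

lemma expSum_continuous (m a : Fin 3 → ℂ) : Continuous (expSum m a) := by
  unfold expSum
  fun_prop

lemma expSum_hasL2Deriv (m a : Fin 3 → ℂ) :
    HasL2Deriv (expSum m a) (expSum m (fun j => a j * m j)) :=
  .of_hasDerivAt (expSum_hasDerivAt m a) (expSum_continuous _ _)

/-- At a zero of the characteristic function, the reference pair solves the eigenvalue equation. -/
lemma adjointGraph_reference {lam m₁ m₂ m₃ : ℂ} (hl : lam ≠ 0) (hm : IsCharRoots lam m₁ m₂ m₃)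
    (hD : eigNum m₁ m₂ m₃ = 0) :
    AdjointGraph (xiFun lam m₁ m₂ m₃, etaFun m₁ m₂ m₃)
      (lam • (xiFun lam m₁ m₂ m₃, etaFun m₁ m₂ m₃)) := by
  set C : Fin 3 → ℂ := ![Complex.exp m₂ - Complex.exp m₃, Complex.exp m₃ - Complex.exp m₁,
    Complex.exp m₁ - Complex.exp m₂] with hC
  set m : Fin 3 → ℂ := ![m₁, m₂, m₃] with hmdef
  set b : Fin 3 → ℂ := fun j => ((m j ^ 2 + -lam) / -lam) * C j with hb
  have hη : etaFun m₁ m₂ m₃ = expSum m C := by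
    funext x
    simp [etaFun, expSum, Fin.sum_univ_three, hC, hmdef]
  have hξ : xiFun lam m₁ m₂ m₃ = expSum m b := by
    funext x
    simp [xiFun, expSum, Fin.sum_univ_three, hC, hmdef, hb]
  have hroot : ∀ j, m j ^ 3 - lam * m j ^ 2 - 2 * lam * m j + lam ^ 2 = 0 := by
    intro j
    rw [hm (m j)]
    fin_cases j <;> simp [hmdef]
  have hb1 : ∀ j, b j * m j + C j * m j = lam * b j := by
    intro j
    simp only [hb]
    field_simp
    linear_combination -C j * hroot j
  have hb2 : ∀ j, C j * m j * m j + C j * m j + b j * m j = lam * C j := by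
    intro j
    have := hb1 j
    have h2 : lam * b j = lam * C j - C j * m j * m j := by
      simp only [hb]
      field_simp
      ring
    linear_combination this + h2
  have eq1 : ∀ x, expSum m (fun j => b j * m j) x + expSum m (fun j => C j * m j) x =
      lam * expSum m b x := by
    intro x
    unfold expSum
    rw [← Finset.sum_add_distrib, Finset.mul_sum]
    refine Finset.sum_congr rfl fun j _ => ?_
    linear_combination Complex.exp (m j * x) * hb1 j
  have eq2 : ∀ x, expSum m (fun j => C j * m j * m j) x + expSum m (fun j => C j * m j) x +
      expSum m (fun j => b j * m j) x = lam * expSum m C x := by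
    intro x
    unfold expSum
    rw [← Finset.sum_add_distrib, ← Finset.sum_add_distrib, Finset.mul_sum]
    refine Finset.sum_congr rfl fun j _ => ?_
    linear_combination Complex.exp (m j * x) * hb2 j
  have hη0 : expSum m C 0 = 0 := by
    rw [← hη]
    simp [etaFun]
  have hη1 : expSum m C 1 = 0 := by
    rw [← hη]
    simp only [etaFun, Complex.ofReal_one, mul_one]
    ring
  have hξ01 : expSum m b 0 = expSum m b 1 := by
    have := xiFun_one_sub_zero hl m₁ m₂ m₃
    rw [hD, neg_zero, zero_div, hξ] at this
    linear_combination -this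
  rw [hη, hξ]
  refine ⟨_, _, _, expSum_hasL2Deriv m b, expSum_hasL2Deriv m C, expSum_hasL2Deriv m _, ?_, hξ01,
    hη0, hη1, .of_forall eq1, .of_forall eq2⟩
  -- The mean-zero condition is automatic: integrating `lam ξ = ξ' + η'` gives boundary terms that
  -- cancel, and `lam ≠ 0`.
  have h1 : ∫ x in (0 : ℝ)..1, lam * expSum m b x = 0 := by
    rw [intervalIntegral.integral_eq_sub_of_hasDerivAt
      (f := fun x => expSum m b x + expSum m C x)
      (f' := fun x => lam * expSum m b x) (fun x _ => ?_)
      ((continuous_const.mul (expSum_continuous m b)).intervalIntegrable _ _)]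
    · simp [hη0, hη1, hξ01]
    · rw [← eq1]
      exact (expSum_hasDerivAt m b x).add (expSum_hasDerivAt m C x)
  rw [intervalIntegral.integral_const_mul] at h1
  exact (mul_eq_zero.1 h1).resolve_left hl

lemma HasL2Deriv.smul {f g : ℝ → ℂ} (c : ℂ) (h : HasL2Deriv f g) : HasL2Deriv (c • f) (c • g) := by
  refine ⟨h.1.const_smul c, fun x hx => ?_⟩
  simp only [Pi.smul_apply, smul_eq_mul]
  rw [intervalIntegral.integral_const_mul, h.2 x hx]
  ring

lemma IsEigenfunction.smul {lam c : ℂ} (hc : c ≠ 0) {Φ : State} (h : IsEigenfunction lam Φ) :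
    IsEigenfunction lam (c • Φ) := by
  obtain ⟨⟨dξ, dη, ddη, h1, h2, h3, h4, h5, h6, h7, h8, h9⟩, x, hx, hne⟩ := h
  refine ⟨⟨c • dξ, c • dη, c • ddη, h1.smul c, h2.smul c, h3.smul c, ?_, ?_, ?_, ?_, ?_, ?_⟩,
    x, hx, ?_⟩
  · simp only [Prod.smul_fst, Pi.smul_apply, smul_eq_mul]
    rw [intervalIntegral.integral_const_mul, h4, mul_zero]
  · simp [h5]
  · simp [h6]
  · simp [h7]
  · filter_upwards [h8] with x hx
    simp only [Prod.smul_fst, Pi.smul_apply, smul_eq_mul] at hx ⊢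
    linear_combination c * hx
  · filter_upwards [h9] with x hx
    simp only [Prod.smul_snd, Pi.smul_apply, smul_eq_mul] at hx ⊢
    linear_combination c * hx
  · simpa [hc] using hne

/-- Nontriviality is read off from `ξ(1) ≠ 0`, so the asymptotic lower bounds on `obsNum` also serve
the existence part. -/
lemma isEigenfunction_reference {lam m₁ m₂ m₃ : ℂ} (hl : lam ≠ 0) (hm : IsCharRoots lam m₁ m₂ m₃)
    (hD : eigNum m₁ m₂ m₃ = 0) (hN : obsNum m₁ m₂ m₃ ≠ 0) :
    IsEigenfunction lam (xiFun lam m₁ m₂ m₃, etaFun m₁ m₂ m₃) := by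
  refine ⟨adjointGraph_reference hl hm hD, 1, by simp, .inl ?_⟩
  simp only [xiFun_one hl]
  exact div_ne_zero (neg_ne_zero.2 hN) hl

/-! ### Zeros of perturbed holomorphic functions -/

/-- Without a zero, `1/f` would be holomorphic and larger at the centre than on the circle, against
the maximum modulus principle. -/
lemma exists_zero_of_norm_lt {f : ℂ → ℂ} {z₀ : ℂ} {r : ℝ} (hr : 0 < r)
    (hf : ∀ z ∈ Metric.closedBall z₀ r, DifferentiableAt ℂ f z)
    (h : ∀ z ∈ Metric.sphere z₀ r, ‖f z₀‖ < ‖f z‖) :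
    ∃ z ∈ Metric.closedBall z₀ r, f z = 0 := by
  by_contra! hne
  obtain ⟨w, hw, hmin⟩ := (isCompact_sphere z₀ r).exists_isMinOn
    (NormedSpace.sphere_nonempty.2 hr.le)
    (fun z hz => (hf z (Metric.sphere_subset_closedBall hz)).continuousAt.norm.continuousWithinAt)
  have hw0 : 0 < ‖f w‖ := (norm_nonneg _).trans_lt (h w hw)
  have hd : DiffContOnCl ℂ (fun z => (f z)⁻¹) (Metric.ball z₀ r) := by
    refine DifferentiableOn.diffContOnCl fun z hz => ?_
    have hz' : z ∈ Metric.closedBall z₀ r := Metric.closure_ball_subset_closedBall hz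
    exact ((hf z hz').inv (hne z hz')).differentiableWithinAt
  have := Complex.norm_le_of_forall_mem_frontier_norm_le Metric.isBounded_ball hd
    (C := ‖f w‖⁻¹) (fun z hz => ?_) (subset_closure (Metric.mem_ball_self hr))
  · rw [norm_inv] at this
    have h0 : 0 < ‖f z₀‖ := norm_pos_iff.2 (hne z₀ (Metric.mem_closedBall_self hr.le))
    exact absurd ((inv_le_inv₀ h0 hw0).1 this) (not_le.2 (h w hw))
  · rw [frontier_ball _ hr.ne'] at hz
    rw [norm_inv]
    gcongr
    exact hmin hz

/-- A small holomorphic perturbation of a function that vanishes at the centre of a disc and is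
bounded below on its boundary has a zero in the disc. -/
lemma exists_zero_of_near {f g : ℂ → ℂ} {z₀ : ℂ} {r c : ℝ} (hr : 0 < r)
    (hf : ∀ z ∈ Metric.closedBall z₀ r, DifferentiableAt ℂ f z) (hg0 : g z₀ = 0)
    (hg : ∀ z ∈ Metric.sphere z₀ r, c ≤ ‖g z‖)
    (hfg : ∀ z ∈ Metric.closedBall z₀ r, ‖f z - g z‖ < c / 2) :
    ∃ z ∈ Metric.closedBall z₀ r, f z = 0 := by
  refine exists_zero_of_norm_lt hr hf fun z hz => ?_
  have h1 := hfg z₀ (Metric.mem_closedBall_self hr.le)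
  have h2 := hfg z (Metric.sphere_subset_closedBall hz)
  have h3 := hg z hz
  have h4 := norm_sub_norm_le (g z) (f z)
  rw [norm_sub_rev] at h4
  rw [hg0, sub_zero] at h1
  linarith

/-! ### Lower bounds in terms of the uniformizing variable -/

lemma exists_of_eventually_cobounded_inf {S : Set ℂ} {P : ℂ → Prop}
    (h : ∀ᶠ z in cobounded ℂ ⊓ 𝓟 S, P z) : ∃ R : ℝ, ∀ z, R ≤ ‖z‖ → z ∈ S → P z := by
  rw [eventually_inf_principal, hasBasis_cobounded_norm.eventually_iff] at h
  obtain ⟨R, -, hR⟩ := h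
  exact ⟨R, fun z hz => hR hz⟩

lemma eventually_regular_cobounded : ∀ᶠ z : ℂ in cobounded ℂ,
    z ≠ 0 ∧ z - 1 / 2 ≠ 0 ∧ z + 1 / 2 ≠ 0 ∧ specParam z ≠ 0 ∧ DifferentiableAt ℂ rootCorr z := by
  have h1 : ∀ᶠ z : ℂ in cobounded ℂ, specParam z / z ^ 2 ≠ 0 :=
    tendsto_specParam_div.eventually (isOpen_ne.mem_nhds one_ne_zero)
  filter_upwards [eventually_ne_cobounded (0 : ℂ), eventually_ne_cobounded (1 / 2 : ℂ),
    eventually_ne_cobounded (-(1 / 2) : ℂ), h1, eventually_differentiableAt_rootCorr]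
    with z a b c d e
  exact ⟨a, sub_ne_zero.2 b, fun h => c (by linear_combination h), fun h => d (by simp [h]), e⟩

lemma eventually_strip_obsNum_ge : ∀ᶠ z in stripFilter, Real.exp (-1) ≤
    ‖obsNum (rootA z) (rootB z) (rootC z) / specParam z‖ * ‖z‖ := by
  have h := tendsto_strip_obsNum.div (tendsto_specParam_div.mono_left stripFilter_le) one_ne_zero
  have h' := h.norm
  have e : ‖-2 * Complex.exp (-1) / 1‖ = 2 * Real.exp (-1) := by
    simp [Complex.norm_exp]
  rw [e] at h'
  have h2 := h'.eventually_const_lt (u := Real.exp (-1)) (by linarith [Real.exp_pos (-1)])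
  filter_upwards [h2, stripFilter_le eventually_regular_cobounded] with z hz ⟨h0, _, _, hs, _⟩
  rw [← norm_mul]
  refine hz.le.trans_eq ?_
  simp only [Pi.div_apply]
  congr 1
  field_simp

lemma eventually_sqStrip_obsNum_ge : ∀ᶠ z in sqStripFilter,
    1 / 2 * Real.exp (-12) * (‖z‖ ^ 2 * Real.exp z.re) ≤
    ‖obsNum (rootA z) (rootB z) (rootC z) / specParam z‖ := by
  have hle := sqStripFilter_le
  have h := tendsto_sqStrip_obsNum.div (tendsto_specParam_div.mono_left hle) one_ne_zero
  have h' := h.norm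
  rw [div_one, norm_one] at h'
  have h2 := h'.eventually_const_lt (u := 1 / 2) (by norm_num)
  have hc : ∀ᶠ z in sqStripFilter, ‖rootCorr z‖ < 1 := by
    have := (tendsto_rootCorr.mono_left hle).norm
    rw [norm_zero] at this
    exact this.eventually_lt_const one_pos
  have hi : ∀ᶠ z : ℂ in sqStripFilter, ‖1 / (z - 1 / 2)‖ < 1 := by
    have := (tendsto_inv_sub_half.mono_left hle).norm
    rw [norm_zero] at this
    exact this.eventually_lt_const one_pos
  filter_upwards [h2, hle eventually_regular_cobounded, hc, hi, eventually_sqStripFilter]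
    with z hz ⟨h0, _, _, hs, _⟩ hc hi hst
  have hA : (rootA z).re = (z ^ 2).re - 1 / 4 - (rootCorr z).re := by
    simp [rootA]
  have hB : (rootB z).re = z.re - 1 / 2 - (1 / (z - 1 / 2)).re := by
    simp only [rootB, Complex.sub_re]
    norm_num
  have a1 := (abs_le.1 ((Complex.abs_re_le_norm (rootCorr z)).trans hc.le)).2
  have a2 := (abs_le.1 ((Complex.abs_re_le_norm (1 / (z - 1 / 2))).trans hi.le)).2
  have a3 := (abs_le.1 hst.1).1
  -- `Re A ≥ -8 - 1/4 - 1` and `Re B ≥ Re z - 1/2 - 1`; the total loss is below `12`.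
  have e1 : Real.exp (-12) * Real.exp z.re ≤ Real.exp (rootA z).re * Real.exp (rootB z).re := by
    rw [← Real.exp_add, ← Real.exp_add]
    exact Real.exp_le_exp.2 (by linarith)
  have e2 : ‖obsNum (rootA z) (rootB z) (rootC z) / specParam z‖ =
      ‖obsNum (rootA z) (rootB z) (rootC z) / z ^ 4 *
        (Complex.exp (-rootA z) * Complex.exp (-rootB z)) / (specParam z / z ^ 2)‖ *
        (‖z‖ ^ 2 * (Real.exp (rootA z).re * Real.exp (rootB z).re)) := by
    rw [← Complex.norm_exp, ← Complex.norm_exp, ← norm_pow, ← norm_mul, ← norm_mul, ← norm_mul,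
      Complex.exp_neg, Complex.exp_neg]
    congr 1
    have := Complex.exp_ne_zero (rootB z)
    have := Complex.exp_ne_zero (rootA z)
    field_simp
  rw [e2]
  simp only [Pi.div_apply] at hz
  calc 1 / 2 * Real.exp (-12) * (‖z‖ ^ 2 * Real.exp z.re)
      = 1 / 2 * (‖z‖ ^ 2 * (Real.exp (-12) * Real.exp z.re)) := by ring
    _ ≤ _ := by gcongr

/-! ### Localization of the uniformizing variable -/

lemma specParam_eq (z : ℂ) : specParam z = z ^ 2 - 5 / 4 - 1 / (z - 1 / 2) := rfl

/-- Each root `m` gives a solution with `z - 1/2 = lam / m - 1`. The product of these three numbers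
is `1`, so one of them has modulus at least `1`; this keeps the term `1/(z - 1/2)` of `specParam`
bounded. -/
lemma exists_specParam_eq {lam m₁ m₂ m₃ : ℂ} (hl : lam ≠ 0) (hm : IsCharRoots lam m₁ m₂ m₃) :
    ∃ z, specParam z = lam ∧ 1 ≤ ‖z - 1 / 2‖ := by
  have key : ∀ m, m ≠ 0 → m ^ 3 - lam * m ^ 2 - 2 * lam * m + lam ^ 2 = 0 →
      specParam (lam / m - 1 + 1 / 2) = lam := by
    intro m hm0 h
    have hne : lam - m ≠ 0 := by
      intro h'
      obtain rfl := sub_eq_zero.1 h'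
      have : lam ^ 2 = 0 := by linear_combination -h
      exact hl (by simpa using this)
    have e : lam / m - 1 + 1 / 2 - 1 / 2 = (lam - m) / m := by field_simp; ring
    rw [specParam_eq, e]
    field_simp
    linear_combination (16 * lam) * h
  obtain ⟨h1, h2, h3⟩ := isCharRoots_iff.1 hm
  have hp : m₁ * m₂ * m₃ ≠ 0 := by rw [h3]; simpa using hl
  have n3 : m₃ ≠ 0 := right_ne_zero_of_mul hp
  have n2 : m₂ ≠ 0 := right_ne_zero_of_mul (left_ne_zero_of_mul hp)
  have n1 : m₁ ≠ 0 := left_ne_zero_of_mul (left_ne_zero_of_mul hp)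
  have hprod : (lam / m₁ - 1) * (lam / m₂ - 1) * (lam / m₃ - 1) = 1 := by
    have := hm lam
    field_simp
    linear_combination -this - h3
  have r1 := key m₁ n1 (by rw [hm]; ring)
  have r2 := key m₂ n2 (by rw [hm]; ring)
  have r3 := key m₃ n3 (by rw [hm]; ring)
  by_contra! hcon
  have c1 := hcon _ r1
  have c2 := hcon _ r2
  have c3 := hcon _ r3
  simp only [add_sub_cancel_right] at c1 c2 c3
  have := congrArg norm hprod
  rw [norm_mul, norm_mul, norm_one] at this
  have h12 := mul_lt_one_of_nonneg_of_lt_one_left (norm_nonneg _) c1 c2.le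
  have h123 := mul_lt_one_of_nonneg_of_lt_one_left (by positivity) h12 c3.le
  linarith

lemma norm_sq_sub_specParam_le {z : ℂ} (h : 1 ≤ ‖z - 1 / 2‖) : ‖z ^ 2 - specParam z‖ ≤ 9 / 4 := by
  have e : z ^ 2 - specParam z = 5 / 4 + 1 / (z - 1 / 2) := by rw [specParam_eq]; ring
  rw [e]
  refine (norm_add_le _ _).trans ?_
  have h1 : ‖1 / (z - 1 / 2)‖ ≤ 1 := by
    rw [norm_div, norm_one]
    exact (div_le_one (by linarith)).2 h
  have h2 : ‖(5 / 4 : ℂ)‖ = 5 / 4 := by norm_num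
  linarith

/-- As `a² - b² = (a - b)(a + b)` and `2‖b‖ ≤ ‖a + b‖ + ‖a - b‖`, one factor has norm at least
`‖b‖`, and the sign of `s` is chosen so that `‖s - b‖` is the other. -/
lemma exists_sq_eq_near (a b : ℂ) : ∃ s, s ^ 2 = a ^ 2 ∧ ‖s - b‖ * ‖b‖ ≤ ‖a ^ 2 - b ^ 2‖ := by
  have e : ‖a ^ 2 - b ^ 2‖ = ‖a - b‖ * ‖a + b‖ := by rw [← norm_mul]; congr 1; ring
  have h : ‖b‖ + ‖b‖ ≤ ‖a + b‖ + ‖a - b‖ := by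
    have := norm_sub_le (a + b) (a - b)
    rw [show a + b - (a - b) = 2 * b by ring, norm_mul] at this
    norm_num at this
    linarith
  rcases le_total ‖b‖ ‖a + b‖ with h' | h'
  · refine ⟨a, rfl, ?_⟩
    rw [e]
    gcongr
  · refine ⟨-a, by ring, ?_⟩
    rw [e, show -a - b = -(a + b) by ring, norm_neg, mul_comm]
    gcongr
    linarith

/-- The other large value of the uniformizing variable for the same spectral parameter. -/
lemma specParam_reflect {z : ℂ} (h1 : z - 1 / 2 ≠ 0) (h2 : z + 1 / 2 ≠ 0) :
    specParam (-z + rootCorr z / (z + 1 / 2)) = specParam z := by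
  have hq := rootCorr_quadratic h1 h2
  -- With `t = z - 1/2`, the image has `t' = -(t + 1) + d`, and the quadratic for `d` says exactly
  -- that `1/t' = -d t`. Then `t' - 1/t' = rootC z`: the reflection moves the rational
  -- parametrization from `rootB z` to `rootC z`.
  obtain ⟨d, hd⟩ : ∃ d, d = rootCorr z / (z + 1 / 2) := ⟨_, rfl⟩
  have hd' : rootCorr z = d * (z + 1 / 2) := by rw [hd, div_mul_cancel₀ _ h2]
  rw [← hd]
  rw [hd'] at hq
  have hq' : d ^ 2 - (z + 1 / 2) * d + 1 / (z - 1 / 2) = 0 := by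
    have : (z + 1 / 2) ^ 2 * (d ^ 2 - (z + 1 / 2) * d + 1 / (z - 1 / 2)) = 0 := by
      linear_combination hq
    exact (mul_eq_zero.1 this).resolve_left (pow_ne_zero 2 h2)
  have hinv : 1 / (z - 1 / 2) * (z - 1 / 2) = 1 := one_div_mul_cancel h1
  have e : (-z + d - 1 / 2) * (-d * (z - 1 / 2)) = 1 := by
    linear_combination -(z - 1 / 2) * hq' + hinv
  have hne : -z + d - 1 / 2 ≠ 0 := left_ne_zero_of_mul (e ▸ one_ne_zero)
  have e' : 1 / (-z + d - 1 / 2) = -d * (z - 1 / 2) := by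
    rw [div_eq_iff hne]; linear_combination -e
  rw [specParam_eq, specParam_eq, e']
  linear_combination hq'

lemma re_sq_eq (z : ℂ) : 2 * z.re ^ 2 = ‖z‖ ^ 2 + (z ^ 2).re := by
  rw [Complex.sq_norm, Complex.normSq_apply, sq, sq, Complex.mul_re]; ring

/-- For bounded `Re lam` and large `lam`, `(Re z)²` is about `|z|²/2`. So if `Re z < 0`, then `Re z
≤ -1`, and the reflected variable, which is `-z` up to an error below `1`, lies in the right half
plane. -/
lemma exists_specParam_eq_re_nonneg : ∃ R : ℝ, ∀ lam m₁ m₂ m₃ : ℂ, R ≤ ‖lam‖ → |lam.re| ≤ 5 →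
    lam ≠ 0 → IsCharRoots lam m₁ m₂ m₃ → ∃ z, specParam z = lam ∧ 1 ≤ ‖z - 1 / 2‖ ∧ 0 ≤ z.re := by
  have h1 : Tendsto (fun z : ℂ => rootCorr z * (z + 1 / 2)⁻¹) (cobounded ℂ) (𝓝 0) := by
    simpa using tendsto_rootCorr.mul (tendsto_inv_add_cobounded (1 / 2))
  have h1' := h1.norm
  rw [norm_zero] at h1'
  have h2 := (h1'.eventually_lt_const one_pos).and eventually_regular_cobounded
  rw [hasBasis_cobounded_norm.eventually_iff] at h2
  obtain ⟨R, -, hR⟩ := h2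
  refine ⟨R ^ 2 + 100, fun lam m₁ m₂ m₃ hl1 hl2 hl hm => ?_⟩
  obtain ⟨z, hz, hz1⟩ := exists_specParam_eq hl hm
  by_cases hre : 0 ≤ z.re
  · exact ⟨z, hz, hz1, hre⟩
  have hn := norm_sq_sub_specParam_le hz1
  rw [hz] at hn
  have hz2 : ‖lam‖ - 9 / 4 ≤ ‖z‖ ^ 2 := by
    have := norm_sub_norm_le lam (z ^ 2)
    rw [norm_sub_rev, norm_pow] at this
    linarith
  have hz3 : R ≤ ‖z‖ := by
    refine le_of_abs_le ?_
    rw [← pow_le_pow_iff_left₀ (abs_nonneg R) (norm_nonneg z) two_ne_zero, sq_abs]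
    linarith
  obtain ⟨g1, g2, g3, g4, _⟩ := hR hz3
  refine ⟨-z + rootCorr z / (z + 1 / 2), by rw [specParam_reflect g3 g4, hz], ?_, ?_⟩
  all_goals rw [← div_eq_mul_inv] at g1
  · have t1 := norm_sub_norm_le z (rootCorr z / (z + 1 / 2) - 1 / 2)
    have t2 := norm_sub_le (rootCorr z / (z + 1 / 2)) (1 / 2)
    have t3 : ‖(1 / 2 : ℂ)‖ = 1 / 2 := by norm_num
    have t4 : ‖-z + rootCorr z / (z + 1 / 2) - 1 / 2‖ =
        ‖z - (rootCorr z / (z + 1 / 2) - 1 / 2)‖ := by rw [← norm_neg]; congr 1; ring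
    have t5 : 3 ≤ ‖z‖ := by nlinarith [norm_nonneg z, sq_nonneg R]
    rw [t4]
    linarith
  · have a1 := (abs_le.1 ((Complex.abs_re_le_norm _).trans g1.le)).1
    have a2 := (abs_le.1 ((Complex.abs_re_le_norm _).trans hn)).1
    have a3 := (abs_le.1 hl2).1
    rw [Complex.sub_re] at a2
    have a4 := re_sq_eq z
    have a5 : z.re ≤ -1 := by nlinarith [sq_nonneg R]
    rw [Complex.add_re, Complex.neg_re]
    linarith

/-! ### Existence of the eigenvalues -/

lemma differentiableAt_eigNum {z : ℂ} (h : DifferentiableAt ℂ rootCorr z) (hz : z - 1 / 2 ≠ 0) :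
    DifferentiableAt ℂ (fun z => eigNum (rootA z) (rootB z) (rootC z)) z := by
  have hA : DifferentiableAt ℂ rootA z := by unfold rootA; fun_prop
  have hB : DifferentiableAt ℂ rootB z := by unfold rootB; fun_prop (disch := assumption)
  have hC : DifferentiableAt ℂ rootC z := by unfold rootC; fun_prop
  unfold eigNum
  fun_prop

/-- `|e^u - 1| ≥ |u| - |u|²`. -/
lemma norm_exp_sub_one_ge {u : ℂ} (hu : ‖u‖ = 1 / 2) : 1 / 4 ≤ ‖Complex.exp u - 1‖ := by
  have h1 := Complex.norm_exp_sub_one_sub_id_le (x := u) (by rw [hu]; norm_num)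
  have h2 := norm_sub_norm_le u (-(Complex.exp u - 1 - u))
  rw [show u - -(Complex.exp u - 1 - u) = Complex.exp u - 1 by ring, norm_neg] at h2
  rw [hu] at h1 h2
  linarith

lemma eventually_exists_strip_zero (R : ℝ) : ∀ᶠ k : ℕ in atTop, ∃ z : ℂ,
    ‖z - k * Real.pi * Complex.I‖ ≤ 1 / 4 ∧ R ≤ ‖z‖ ∧
      eigNum (rootA z) (rootB z) (rootC z) = 0 := by
  -- On the circle, `|e^{-z - 1/2}| ≥ e^{-3/4} ≥ e^{-1}`, and the factor `e^{2(z - ikπ)} - 1` has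
  -- modulus at least `1/4`, because radius `1/4` in `z` is radius `1/2` in the exponent.
  set c : ℝ := Real.exp (-1) * (1 / 4) with hc
  have hcpos : 0 < c := by positivity
  have h1 := tendsto_strip_eigNum.norm
  rw [norm_zero] at h1
  obtain ⟨S, hS⟩ := exists_of_eventually_cobounded_inf
    ((h1.eventually_lt_const (half_pos hcpos)).and (stripFilter_le eventually_regular_cobounded))
  filter_upwards [eventually_ge_atTop ⌈max R S + 1⌉₊] with k hk
  have hk' : max R S + 1 ≤ k := Nat.ceil_le.1 hk
  have hball : ∀ z ∈ Metric.closedBall (k * Real.pi * Complex.I : ℂ) (1 / 4),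
      max R S ≤ ‖z‖ ∧ |z.re| ≤ 1 / 4 := by
    intro z hz
    rw [mem_closedBall_iff_norm] at hz
    constructor
    · have t := norm_sub_norm_le (k * Real.pi * Complex.I : ℂ) (k * Real.pi * Complex.I - z)
      rw [sub_sub_cancel, norm_sub_rev _ z] at t
      have : ‖(k * Real.pi * Complex.I : ℂ)‖ = k * Real.pi := by
        simp [abs_of_pos Real.pi_pos]
      have hpi := Real.pi_gt_three
      have : (k : ℝ) ≤ k * Real.pi := le_mul_of_one_le_right (by positivity) (by linarith)
      linarith
    · have := (Complex.abs_re_le_norm _).trans hz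
      simpa using this
  have hgood : ∀ z ∈ Metric.closedBall (k * Real.pi * Complex.I : ℂ) (1 / 4), _ := fun z hz =>
    hS z ((le_max_right _ _).trans (hball z hz).1) ((hball z hz).2.trans (by norm_num))
  obtain ⟨z, hz, hz0⟩ := exists_zero_of_near
    (f := fun z => eigNum (rootA z) (rootB z) (rootC z) / z ^ 4)
    (g := fun z => -(Complex.exp (z - 1 / 2) - Complex.exp (-z - 1 / 2)))
    (z₀ := (k * Real.pi * Complex.I : ℂ)) (r := 1 / 4) (c := c) (by norm_num)
    (fun z hz => by
      obtain ⟨_, h0, h1, _, _, h3⟩ := hgood z hz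
      exact (differentiableAt_eigNum h3 h1).div (by fun_prop) (pow_ne_zero 4 h0))
    (by
      have e := Complex.exp_nat_mul_two_pi_mul_I k
      rw [neg_eq_zero, sub_eq_zero]
      rw [show (k * Real.pi * Complex.I : ℂ) - 1 / 2 =
        (-(k * Real.pi * Complex.I) - 1 / 2) + k * (2 * Real.pi * Complex.I) by ring,
        Complex.exp_add, e, mul_one])
    (fun z hz => by
      have hz' := (hball z (Metric.sphere_subset_closedBall hz)).2
      rw [mem_sphere_iff_norm] at hz
      have e := Complex.exp_nat_mul_two_pi_mul_I k
      have e2 : -(Complex.exp (z - 1 / 2) - Complex.exp (-z - 1 / 2)) =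
          -(Complex.exp (-z - 1 / 2) * (Complex.exp (2 * (z - k * Real.pi * Complex.I)) - 1)) := by
        have : Complex.exp (z - 1 / 2) = Complex.exp (-z - 1 / 2) *
            Complex.exp (2 * (z - k * Real.pi * Complex.I)) := by
          rw [← Complex.exp_add, ← mul_one (Complex.exp (_ + _)), ← e, ← Complex.exp_add]
          congr 1; ring
        rw [this]; ring
      rw [e2, norm_neg, norm_mul, Complex.norm_exp, hc]
      have h1 := norm_exp_sub_one_ge (u := 2 * (z - k * Real.pi * Complex.I))
        (by rw [norm_mul, hz]; norm_num)
      have h2 := (abs_le.1 hz').2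
      gcongr
      simp
      linarith)
    (fun z hz => by
      have := (hgood z hz).1
      rwa [sub_neg_eq_add])
  obtain ⟨hn, h0, _⟩ := hgood z hz
  refine ⟨z, mem_closedBall_iff_norm.1 hz, (le_max_left _ _).trans (hball z hz).1, ?_⟩
  exact (div_eq_zero_iff.1 hz0).resolve_right (pow_ne_zero 4 h0)

/-- The principal branch of `√(w + 1/4)`. -/
def sqrtShift (w : ℂ) : ℂ := (w + 1 / 4) ^ (((2 : ℕ) : ℂ)⁻¹)

lemma sqrtShift_sq (w : ℂ) : sqrtShift w ^ 2 = w + 1 / 4 :=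
  Complex.cpow_nat_inv_pow _ two_ne_zero

lemma sqrtShift_re_nonneg (w : ℂ) : 0 ≤ (sqrtShift w).re := by
  unfold sqrtShift
  by_cases h : w + 1 / 4 = 0
  · rw [h]; simp
  rw [Complex.cpow_def_of_ne_zero h, Complex.exp_re]
  refine mul_nonneg (Real.exp_pos _).le (Real.cos_nonneg_of_mem_Icc ?_)
  have e : (Complex.log (w + 1 / 4) * ((2 : ℕ) : ℂ)⁻¹).im = (w + 1 / 4).arg / 2 := by
    have : ((2 : ℕ) : ℂ)⁻¹ = ((1 / 2 : ℝ) : ℂ) := by norm_num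
    rw [this, Complex.im_mul_ofReal, Complex.log_im]
    ring
  rw [e]
  have h1 := Complex.neg_pi_lt_arg (w + 1 / 4)
  have h2 := Complex.arg_le_pi (w + 1 / 4)
  constructor <;> linarith

/-- The limit function `e^w - 1` is simple in `w = z² - 1/4`, so the zero is sought in a `w`-disc
about `-2πik`. For large `|k|` this disc misses the real axis, so the principal root `sqrtShift` is
holomorphic there, and its values have nonnegative real part. -/
lemma eventually_exists_sqStrip_zero (R : ℝ) : ∃ K : ℝ, ∀ k : ℤ, K ≤ |(k : ℝ)| → ∃ z : ℂ,
    ‖z ^ 2 - 1 / 4 - -(k * (2 * Real.pi * Complex.I))‖ ≤ 1 / 2 ∧ R ≤ ‖z‖ ∧ 0 ≤ z.re ∧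
      eigNum (rootA z) (rootB z) (rootC z) = 0 := by
  have h1 := tendsto_sqStrip_eigNum.norm
  rw [norm_zero] at h1
  obtain ⟨S, hS⟩ := exists_of_eventually_cobounded_inf
    ((h1.eventually_lt_const (by norm_num : (0 : ℝ) < 1 / 4 / 2)).and
      (sqStripFilter_le eventually_regular_cobounded))
  refine ⟨max R S ^ 2 + 1, fun k hk => ?_⟩
  have hball : ∀ w ∈ Metric.closedBall (-(k * (2 * Real.pi * Complex.I)) : ℂ) (1 / 2),
      max R S ≤ ‖sqrtShift w‖ ∧ |w.re| ≤ 1 / 2 ∧ w.im ≠ 0 := by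
    intro w hw
    rw [mem_closedBall_iff_norm] at hw
    have hre := (Complex.abs_re_le_norm _).trans hw
    have him := (Complex.abs_im_le_norm _).trans hw
    simp at hre him
    have hpi := Real.pi_gt_three
    have hk2 : |(k : ℝ)| * 6 ≤ |(k : ℝ) * (2 * Real.pi)| := by
      rw [abs_mul, abs_of_pos (by positivity : 0 < 2 * Real.pi)]
      gcongr
      linarith
    have him2 : 1 ≤ |w.im| ∧ |(k : ℝ)| ≤ |w.im| := by
      have t := abs_sub_abs_le_abs_sub ((k : ℝ) * (2 * Real.pi)) (k * (2 * Real.pi) + w.im)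
      rw [show (k : ℝ) * (2 * Real.pi) - (k * (2 * Real.pi) + w.im) = -w.im by ring, abs_neg,
        add_comm (_ * _)] at t
      have : 1 ≤ |(k : ℝ)| := by nlinarith [sq_nonneg (max R S)]
      constructor <;> linarith
    refine ⟨?_, by rw [one_div]; exact hre, fun h => ?_⟩
    · refine le_of_abs_le ?_
      rw [← pow_le_pow_iff_left₀ (abs_nonneg _) (norm_nonneg _) two_ne_zero, sq_abs, ← norm_pow,
        sqrtShift_sq]
      have := Complex.abs_im_le_norm (w + 1 / 4)
      simp at this
      norm_num
      linarith
    · rw [h, abs_zero] at him2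
      linarith
  have hgood : ∀ w ∈ Metric.closedBall (-(k * (2 * Real.pi * Complex.I)) : ℂ) (1 / 2), _ :=
    fun w hw => hS (sqrtShift w) ((le_max_right _ _).trans (hball w hw).1)
      ⟨by
        rw [sqrtShift_sq]
        have := abs_le.1 (hball w hw).2.1
        rw [Complex.add_re, abs_le]
        norm_num
        constructor <;> linarith, sqrtShift_re_nonneg w⟩
  obtain ⟨w, hw, hw0⟩ := exists_zero_of_near
    (f := fun w => eigNum (rootA (sqrtShift w)) (rootB (sqrtShift w)) (rootC (sqrtShift w)) /
      sqrtShift w ^ 4 * Complex.exp (-rootB (sqrtShift w)))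
    (g := fun w => Complex.exp w - 1)
    (z₀ := (-(k * (2 * Real.pi * Complex.I)) : ℂ)) (r := 1 / 2) (c := 1 / 4) (by norm_num)
    (fun w hw => by
      obtain ⟨_, h0, h1, _, _, h3⟩ := hgood w hw
      have hs : DifferentiableAt ℂ sqrtShift w := by
        refine DifferentiableAt.cpow_const (by fun_prop) (.inr ?_)
        simpa using (hball w hw).2.2
      have hB : DifferentiableAt ℂ rootB (sqrtShift w) := by
        unfold rootB; fun_prop (disch := assumption)
      have hp : DifferentiableAt ℂ (fun z : ℂ => z ^ 4) (sqrtShift w) := by fun_prop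
      have hf : DifferentiableAt ℂ (fun z => eigNum (rootA z) (rootB z) (rootC z) / z ^ 4 *
          Complex.exp (-rootB z)) (sqrtShift w) :=
        ((differentiableAt_eigNum h3 h1).div hp (pow_ne_zero 4 h0)).mul hB.neg.cexp
      exact hf.comp w hs)
    (by
      have e := Complex.exp_int_mul_two_pi_mul_I k
      rw [Complex.exp_neg, e, inv_one, sub_self])
    (fun w hw => by
      rw [mem_sphere_iff_norm] at hw
      have e := Complex.exp_int_mul_two_pi_mul_I k
      have h1 := norm_exp_sub_one_ge hw
      rwa [sub_neg_eq_add, Complex.exp_add, e, mul_one] at h1)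
    (fun w hw => by
      have := (hgood w hw).1
      rwa [sqrtShift_sq, add_sub_cancel_right] at this)
  obtain ⟨hn, h0, _⟩ := hgood w hw
  refine ⟨sqrtShift w, ?_, (le_max_left _ _).trans (hball w hw).1, sqrtShift_re_nonneg w, ?_⟩
  · rw [sqrtShift_sq, add_sub_cancel_right]
    exact mem_closedBall_iff_norm.1 hw
  · have := (mul_eq_zero.1 hw0).resolve_right (Complex.exp_ne_zero _)
    exact (div_eq_zero_iff.1 this).resolve_right (pow_ne_zero 4 h0)

lemma one_le_norm_sub_half {z : ℂ} (h : 3 ≤ ‖z‖) : 1 ≤ ‖z - 1 / 2‖ := by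
  have t := norm_sub_norm_le z (1 / 2)
  have : ‖(1 / 2 : ℂ)‖ = 1 / 2 := by norm_num
  linarith

lemma specParam_ne_zero {z : ℂ} (h : 3 ≤ ‖z‖) : specParam z ≠ 0 := by
  intro h0
  have := norm_sq_sub_specParam_le (one_le_norm_sub_half h)
  rw [h0, sub_zero, norm_pow] at this
  nlinarith

lemma isCharRoots_of_norm_ge {z : ℂ} (h : 3 ≤ ‖z‖) :
    IsCharRoots (specParam z) (rootA z) (rootB z) (rootC z) := by
  refine isCharRoots_param (norm_pos_iff.1 (by linarith [one_le_norm_sub_half h])) fun h0 => ?_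
  have : z = -(1 / 2) := by linear_combination h0
  rw [this] at h
  norm_num at h

lemma norm_xiFun_one {z lam m₁ m₂ m₃ : ℂ} (h : 3 ≤ ‖z‖) (hz : specParam z = lam)
    (hm : IsCharRoots lam m₁ m₂ m₃) :
    ‖xiFun lam m₁ m₂ m₃ 1‖ = ‖obsNum (rootA z) (rootB z) (rootC z) / specParam z‖ := by
  subst hz
  rw [(isCharRoots_of_norm_ge h).norm_xiFun_eq hm, xiFun_one (specParam_ne_zero h), neg_div,
    norm_neg]

lemma exists_parabolicBranch : ∃ K : ℕ, ∀ k₀ : ℕ, K ≤ k₀ → ∃ (lam : ℕ → ℂ) (Φ : ℕ → State),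
    IsParabolicBranch k₀ lam Φ := by
  obtain ⟨R, hR⟩ := exists_of_eventually_cobounded_inf eventually_strip_obsNum_ge
  obtain ⟨K, hK⟩ := eventually_atTop.1 (eventually_exists_strip_zero (max R 3))
  have hex : ∀ k : ℕ, ∃ p : ℂ × State, K ≤ k →
      (∃ c d : ℝ, |c| ≤ Real.pi / 2 ∧ |d| ≤ Real.pi / 2 ∧
        p.1 = -(((k * Real.pi + c : ℝ) : ℂ) + d * Complex.I) ^ 2) ∧
      IsEigenfunction p.1 p.2 ∧ IsReference p.1 p.2 := by
    intro k
    by_cases hk : K ≤ k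
    swap
    -- Dummy value for the small indices, so that one choice function covers all `k`.
    · exact ⟨(0, 0), fun h => absurd h hk⟩
    obtain ⟨z, hz1, hz2, hz3⟩ := hK k hk
    have hz4 : 3 ≤ ‖z‖ := (le_max_right _ _).trans hz2
    have hre : |z.re| ≤ 4 := by
      have := (Complex.abs_re_le_norm _).trans hz1
      simp at this
      linarith
    have hN : obsNum (rootA z) (rootB z) (rootC z) ≠ 0 := by
      intro h0
      have := hR z ((le_max_left _ _).trans hz2) hre
      rw [h0, zero_div, norm_zero, zero_mul] at this
      exact absurd this (not_le.2 (Real.exp_pos _))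
    have hl := specParam_ne_zero hz4
    have hm := isCharRoots_of_norm_ge hz4
    refine ⟨(specParam z, (xiFun (specParam z) (rootA z) (rootB z) (rootC z),
      etaFun (rootA z) (rootB z) (rootC z))), fun _ => ⟨?_, isEigenfunction_reference hl hm hz3 hN,
      _, _, _, hm, rfl⟩⟩
    -- The number `kπ + c + i d` must be a square root of `-lam`. The one near `-iz` is within `3/4`
    -- of it, since `(9/4)/3 = 3/4`, and `-iz` is within `1/4` of `kπ`; the total `1` is below
    -- `π/2`.
    obtain ⟨a, ha⟩ := IsAlgClosed.exists_pow_nat_eq (-specParam z) two_pos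
    obtain ⟨s, hs1, hs2⟩ := exists_sq_eq_near a (-Complex.I * z)
    have hb : a ^ 2 - (-Complex.I * z) ^ 2 = z ^ 2 - specParam z := by
      rw [ha]; linear_combination (-z ^ 2) * Complex.I_sq
    have hnb : ‖-Complex.I * z‖ = ‖z‖ := by simp
    rw [hb, hnb] at hs2
    have hs3 : ‖s - -Complex.I * z‖ ≤ 3 / 4 := by
      have := norm_sq_sub_specParam_le (one_le_norm_sub_half hz4)
      nlinarith [norm_nonneg (s - -Complex.I * z)]
    have hs4 : ‖-Complex.I * z - k * Real.pi‖ ≤ 1 / 4 := by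
      have e : -Complex.I * z - k * Real.pi = -Complex.I * (z - k * Real.pi * Complex.I) := by
        linear_combination (-k * Real.pi) * Complex.I_sq
      rw [e, norm_mul]
      simpa using hz1
    have hs5 : ‖s - k * Real.pi‖ ≤ 1 := by
      have := norm_add_le (s - -Complex.I * z) (-Complex.I * z - k * Real.pi)
      rw [sub_add_sub_cancel] at this
      linarith
    have hpi := Real.pi_gt_three
    have h1 := (Complex.abs_re_le_norm _).trans hs5
    have h2 := (Complex.abs_im_le_norm _).trans hs5
    refine ⟨s.re - k * Real.pi, s.im, ?_, ?_, ?_⟩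
    · simp at h1
      linarith
    · simp at h2
      linarith
    · have e : (((k * Real.pi + (s.re - k * Real.pi) : ℝ) : ℂ) + s.im * Complex.I) = s := by
        rw [add_sub_cancel, Complex.re_add_im]
      rw [e, hs1, ha, neg_neg]
  choose p hp using hex
  exact ⟨K, fun k₀ hk₀ => ⟨fun k => (p k).1, fun k => (p k).2, fun k hk => hp k (hk₀.trans hk)⟩⟩

lemma hypScale_ne_zero {k : ℤ} (hk : k ≠ 0) : hypScale k ≠ 0 := by
  unfold hypScale
  have : (k : ℝ) ≠ 0 := by exact_mod_cast hk
  have := Real.pi_ne_zero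
  positivity

lemma exists_hyperbolicBranch : ∃ K : ℕ, ∀ k₀ : ℕ, K ≤ k₀ → ∃ (lam : ℤ → ℂ) (Φ : ℤ → State),
    IsHyperbolicBranch k₀ lam Φ := by
  obtain ⟨R, hR⟩ := exists_of_eventually_cobounded_inf eventually_sqStrip_obsNum_ge
  obtain ⟨K, hK⟩ := eventually_exists_sqStrip_zero (max R 3)
  have hex : ∀ k : ℤ, ∃ p : ℂ × State, (max K 1 ≤ |(k : ℝ)|) →
      (∃ a b : ℝ, |a| ≤ Real.pi / 2 ∧ |b| ≤ Real.pi / 2 ∧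
        p.1 = -(((1 + a : ℝ) : ℂ) + ((2 * k * Real.pi + b : ℝ) : ℂ) * Complex.I)) ∧
      IsEigenfunction p.1 p.2 ∧
      ∃ Φ₀ : State, IsReference p.1 Φ₀ ∧ p.2 = ((hypScale k : ℂ)⁻¹) • Φ₀ := by
    intro k
    by_cases hk : max K 1 ≤ |(k : ℝ)|
    swap
    · exact ⟨(0, 0), fun h => absurd h hk⟩
    obtain ⟨z, hz1, hz2, hz3, hz5⟩ := hK k ((le_max_left _ _).trans hk)
    have hk0 : k ≠ 0 := by
      rintro rfl
      have := (le_max_right _ _).trans hk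
      norm_num at this
    have hz4 : 3 ≤ ‖z‖ := (le_max_right _ _).trans hz2
    have hre : |(z ^ 2).re| ≤ 8 := by
      have := (Complex.abs_re_le_norm _).trans hz1
      simp only [Complex.sub_re, Complex.neg_re, Complex.mul_re, Complex.intCast_re,
        Complex.intCast_im, Complex.I_re, Complex.I_im, Complex.ofReal_re, Complex.ofReal_im,
        Complex.mul_im] at this
      norm_num at this
      rw [abs_le] at this ⊢
      constructor <;> linarith
    have hN : obsNum (rootA z) (rootB z) (rootC z) ≠ 0 := by
      intro h0
      have := hR z ((le_max_left _ _).trans hz2) ⟨hre, hz3⟩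
      rw [h0, zero_div, norm_zero] at this
      exact absurd this (not_le.2 (by positivity))
    have hl := specParam_ne_zero hz4
    have hm := isCharRoots_of_norm_ge hz4
    refine ⟨(specParam z, ((hypScale k : ℂ)⁻¹) •
      (xiFun (specParam z) (rootA z) (rootB z) (rootC z),
      etaFun (rootA z) (rootB z) (rootC z))), fun _ => ⟨?_,
      (isEigenfunction_reference hl hm hz5 hN).smul
        (inv_ne_zero (Complex.ofReal_ne_zero.2 (hypScale_ne_zero hk0))),
      _, ⟨_, _, _, hm, rfl⟩, rfl⟩⟩
    -- The disc contributes `1/2` and the term `1/(z - 1/2)` at most `1`; the sum `3/2` is below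
    -- `π/2`.
    have hn : ‖specParam z + 1 + k * (2 * Real.pi * Complex.I)‖ ≤ 3 / 2 := by
      have e : specParam z + 1 + k * (2 * Real.pi * Complex.I) =
          (z ^ 2 - 1 / 4 - -(k * (2 * Real.pi * Complex.I))) - 1 / (z - 1 / 2) := by
        rw [specParam_eq]; ring
      have h1 : ‖1 / (z - 1 / 2)‖ ≤ 1 := by
        rw [norm_div, norm_one]
        have := one_le_norm_sub_half hz4
        exact (div_le_one (by linarith)).2 this
      rw [e]
      exact (norm_sub_le _ _).trans (by linarith)
    have hpi := Real.pi_gt_three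
    have h1 := (Complex.abs_re_le_norm _).trans hn
    have h2 := (Complex.abs_im_le_norm _).trans hn
    refine ⟨-(specParam z).re - 1, -(specParam z).im - 2 * k * Real.pi, ?_, ?_, ?_⟩
    · simp at h1
      rw [← abs_neg]
      refine le_trans (le_of_eq ?_) (h1.trans (by linarith))
      congr 1; ring
    · simp at h2
      rw [← abs_neg]
      refine le_trans (le_of_eq ?_) (h2.trans (by linarith))
      congr 1; ring
    · apply Complex.ext <;> simp
  choose p hp using hex
  refine ⟨⌈max K 1⌉₊, fun k₀ hk₀ => ⟨fun k => (p k).1, fun k => (p k).2, fun k hk => hp k ?_⟩⟩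
  have h1 : max K 1 ≤ (k₀ : ℝ) := Nat.ceil_le.1 hk₀
  have h2 : ((k₀ : ℤ) : ℝ) ≤ ((|k| : ℤ) : ℝ) := by exact_mod_cast hk
  rw [Int.cast_abs] at h2
  exact h1.trans h2

/-! ### Lower bounds for the observations -/

lemma exists_pos_le_of_finite {ι : Type*} {S T : Set ι} {g : ι → ℝ} {c : ℝ} (hc : 0 < c)
    (hT : T.Finite) (hg : ∀ k ∈ S, 0 < g k) (h : ∀ k ∈ S, k ∉ T → c ≤ g k) :
    ∃ C : ℝ, 0 < C ∧ ∀ k ∈ S, C ≤ g k := by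
  have hfin : ∃ C : ℝ, 0 < C ∧ ∀ k ∈ S ∩ T, C ≤ g k := by
    rcases (S ∩ T).eq_empty_or_nonempty with he | hne
    · exact ⟨1, one_pos, by simp [he]⟩
    · obtain ⟨a, ha, hmin⟩ := (hT.inter_of_right S).exists_minimalFor g _ hne
      exact ⟨g a, hg a ha.1, fun k hk => (le_total (g a) (g k)).elim id (hmin hk)⟩
  obtain ⟨C, hC, hCg⟩ := hfin
  refine ⟨min c C, lt_min hc hC, fun k hk => ?_⟩
  by_cases hkT : k ∈ T
  · exact (min_le_right _ _).trans (hCg k ⟨hk, hkT⟩)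
  · exact (min_le_left _ _).trans (h k hk hkT)

/-- The branch form of `lam` places the uniformizing variable near `±iμ`, with `μ = kπ + c + i d`.
Hence it lies in the vertical strip, with `|z|` at most a multiple of `kπ`. -/
lemma parabolic_lower_bound : ∃ K : ℕ, ∀ (k : ℕ) (lam : ℂ) (Φ : State) (c d : ℝ), K ≤ k →
    |c| ≤ Real.pi / 2 → |d| ≤ Real.pi / 2 →
    lam = -(((k * Real.pi + c : ℝ) : ℂ) + d * Complex.I) ^ 2 → lam ≠ 0 → IsReference lam Φ →
    Real.exp (-1) / 3 ≤ ‖observation Φ‖ * (k * Real.pi) := by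
  obtain ⟨R, hR⟩ := exists_of_eventually_cobounded_inf eventually_strip_obsNum_ge
  refine ⟨⌈max R 3 + 3⌉₊, fun k lam Φ c d hk hc hd hlam hl ⟨m₁, m₂, m₃, hm, hΦ⟩ => ?_⟩
  have hk' : max R 3 + 3 ≤ k := Nat.ceil_le.1 hk
  obtain ⟨z, hz, hz1⟩ := exists_specParam_eq hl hm
  have hpi := Real.pi_gt_three
  have hpi4 := Real.pi_lt_four
  have hkpi : (k : ℝ) * 3 ≤ k * Real.pi := by gcongr
  have hR3 : 3 ≤ max R 3 := le_max_right _ _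
  set μ : ℂ := ((k * Real.pi + c : ℝ) : ℂ) + d * Complex.I with hμ
  have hμre : μ.re = k * Real.pi + c := by simp [hμ]
  have hμim : μ.im = d := by simp [hμ]
  have hc' := abs_le.1 hc
  have hμn : k * Real.pi - 2 ≤ ‖μ‖ := by
    have := (le_abs_self _).trans (Complex.abs_re_le_norm μ)
    rw [hμre] at this
    linarith
  have hμn2 : ‖μ‖ ≤ k * Real.pi + 4 := by
    have := Complex.norm_le_abs_re_add_abs_im μ
    rw [hμre, hμim] at this
    have h2 := abs_add_le ((k : ℝ) * Real.pi) c
    rw [abs_of_nonneg (by positivity : 0 ≤ (k : ℝ) * Real.pi)] at h2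
    linarith
  obtain ⟨s, hs1, hs2⟩ := exists_sq_eq_near (Complex.I * μ) z
  have hlam' : (Complex.I * μ) ^ 2 = lam := by
    rw [hlam]; linear_combination μ ^ 2 * Complex.I_sq
  rw [hlam', ← hz, norm_sub_rev (specParam z)] at hs2
  rw [hlam'] at hs1
  have hn := norm_sq_sub_specParam_le hz1
  have hsn : ‖s‖ = ‖μ‖ := by
    rw [← pow_left_inj₀ (norm_nonneg _) (norm_nonneg _) two_ne_zero, ← norm_pow, ← norm_pow, hs1,
      hlam, norm_neg]
  have hzlow : ‖μ‖ - 1 ≤ ‖z‖ := by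
    rw [hz] at hn
    have h1 := norm_sub_norm_le lam (z ^ 2)
    rw [norm_sub_rev, ← hs1, norm_pow, norm_pow, hsn, hs1] at h1
    nlinarith [norm_nonneg z]
  have hz3 : 3 ≤ ‖z‖ := by linarith
  have hsz : ‖s - z‖ ≤ 3 / 4 := by nlinarith [norm_nonneg (s - z)]
  have hzup : ‖z‖ ≤ ‖μ‖ + 1 := by
    have := norm_sub_norm_le z s
    rw [norm_sub_rev, hsn] at this
    linarith
  -- `s = ±iμ`, so its real part is `∓d`.
  have hsre : |s.re| ≤ 2 := by
    rcases sq_eq_sq_iff_eq_or_eq_neg.1 (hs1.trans hlam'.symm) with h | h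
    · rw [h, Complex.mul_re]; simp [hμim]; linarith
    · rw [h, Complex.neg_re, Complex.mul_re]; simp [hμim]; linarith
  have hzre : |z.re| ≤ 4 := by
    have h1 := (Complex.abs_re_le_norm _).trans hsz
    rw [Complex.sub_re] at h1
    rw [abs_le] at *
    constructor <;> linarith
  have key := hR z ((le_max_left R 3).trans (by linarith)) hzre
  have hobs : ‖observation Φ‖ = ‖obsNum (rootA z) (rootB z) (rootC z) / specParam z‖ := by
    rw [hΦ]
    exact norm_xiFun_one hz3 hz hm
  rw [hobs]
  have : ‖z‖ ≤ 3 * (k * Real.pi) := by linarith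
  have := mul_le_mul_of_nonneg_left this
    (norm_nonneg (obsNum (rootA z) (rootB z) (rootC z) / specParam z))
  linarith

/-- The scale has size at most `q e^{√q + 1}` with `q = |k|π`, while `|z|² ≥ q` and `Re z ≥ √q - 2`;
the two growths match up to the factor `e^{-3}`. -/
lemma hyperbolic_lower_bound : ∃ K c₀ : ℝ, 0 < c₀ ∧ ∀ (k : ℤ) (lam : ℂ) (Φ₀ : State) (a b : ℝ),
    K ≤ |(k : ℝ)| → |a| ≤ Real.pi / 2 → |b| ≤ Real.pi / 2 →
    lam = -(((1 + a : ℝ) : ℂ) + ((2 * k * Real.pi + b : ℝ) : ℂ) * Complex.I) → lam ≠ 0 →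
    IsReference lam Φ₀ → c₀ ≤ ‖observation (((hypScale k : ℂ)⁻¹) • Φ₀)‖ := by
  obtain ⟨R, hR⟩ := exists_of_eventually_cobounded_inf eventually_sqStrip_obsNum_ge
  obtain ⟨R', hR'⟩ := exists_specParam_eq_re_nonneg
  refine ⟨max R' (R ^ 2) + 10, 1 / 2 * Real.exp (-12) * Real.exp (-3), by positivity,
    fun k lam Φ₀ a b hk ha hb hlam hl ⟨m₁, m₂, m₃, hm, hΦ⟩ => ?_⟩
  have hpi := Real.pi_gt_three
  have hpi4 : Real.pi / 2 ≤ 7 / 4 := by linarith [Real.pi_lt_d2]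
  have hR2 : R ^ 2 ≤ max R' (R ^ 2) := le_max_right _ _
  have hR2' := sq_nonneg R
  have hre : lam.re = -(1 + a) := by rw [hlam]; simp
  have him : lam.im = -(2 * k * Real.pi + b) := by rw [hlam]; simp
  set q : ℝ := |(k : ℝ)| * Real.pi with hq
  have hqk : |(k : ℝ)| * 3 ≤ q := by rw [hq]; gcongr
  have hkq : |(k : ℝ) * Real.pi| = q := by rw [abs_mul, abs_of_pos Real.pi_pos]
  have hlre : |lam.re| ≤ 11 / 4 := by
    rw [hre, abs_neg]
    have := abs_add_le 1 a
    rw [abs_one] at this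
    linarith
  have hlim : 2 * q - 7 / 4 ≤ ‖lam‖ := by
    refine le_trans ?_ (Complex.abs_im_le_norm lam)
    rw [him, abs_neg]
    have := abs_sub_abs_le_abs_sub (2 * (k : ℝ) * Real.pi) (-b)
    rw [sub_neg_eq_add, abs_neg, mul_assoc, abs_mul, hkq, abs_two] at this
    rw [mul_assoc]
    linarith
  obtain ⟨z, hz, hz1, hz0⟩ := hR' lam m₁ m₂ m₃ (by linarith [le_max_left R' (R ^ 2)])
    (by linarith) hl hm
  have hn := norm_sq_sub_specParam_le hz1
  rw [hz] at hn
  have hzn : 2 * q - 4 ≤ ‖z‖ ^ 2 := by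
    have := norm_sub_norm_le lam (z ^ 2)
    rw [norm_sub_rev, norm_pow] at this
    linarith
  have hz2re : |(z ^ 2).re| ≤ 5 := by
    have h1 := (Complex.abs_re_le_norm _).trans hn
    rw [Complex.sub_re] at h1
    rw [abs_le] at *
    constructor <;> linarith
  have hz3 : 3 ≤ ‖z‖ := by nlinarith [norm_nonneg z]
  have hzR : R ≤ ‖z‖ := by
    refine le_of_abs_le ?_
    rw [← pow_le_pow_iff_left₀ (abs_nonneg R) (norm_nonneg z) two_ne_zero, sq_abs]
    linarith
  have key := hR z hzR ⟨by linarith, hz0⟩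
  -- `2 (Re z)² = |z|² + Re z² ≥ 2q - 9`, and for `√q ≥ 5` this exceeds `2 (√q - 2)²`.
  have hzre : Real.sqrt q - 2 ≤ z.re := by
    have h1 := re_sq_eq z
    have h2 := (abs_le.1 hz2re).1
    have h3 : Real.sqrt q ^ 2 = q := Real.sq_sqrt (by positivity)
    have h4 : 5 ≤ Real.sqrt q := by
      rw [Real.le_sqrt' (by norm_num)]
      linarith
    nlinarith
  have hS : |hypScale k| ≤ q * Real.exp (Real.sqrt q + 1) := by
    unfold hypScale
    rw [abs_mul, hkq, abs_of_pos (Real.exp_pos _)]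
    have : 1 / Real.sqrt |(k : ℝ)| ≤ 1 := by
      have : 1 ≤ Real.sqrt |(k : ℝ)| := by
        rw [Real.one_le_sqrt]
        linarith
      exact (div_le_one (by linarith)).2 this
    gcongr
  have hSpos : 0 < |hypScale k| := by
    refine abs_pos.2 (hypScale_ne_zero ?_)
    rintro rfl
    simp at hk
    linarith
  have hobs : ‖observation (((hypScale k : ℂ)⁻¹) • Φ₀)‖ =
      |hypScale k|⁻¹ * ‖obsNum (rootA z) (rootB z) (rootC z) / specParam z‖ := by
    rw [hΦ, ← norm_xiFun_one hz3 hz hm]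
    simp [observation]
  rw [hobs, inv_mul_eq_div, le_div_iff₀ hSpos]
  calc 1 / 2 * Real.exp (-12) * Real.exp (-3) * |hypScale k|
      ≤ 1 / 2 * Real.exp (-12) * Real.exp (-3) * (q * Real.exp (Real.sqrt q + 1)) := by gcongr
    _ = 1 / 2 * Real.exp (-12) * (q * Real.exp (Real.sqrt q - 2)) := by
        rw [show Real.sqrt q - 2 = -3 + (Real.sqrt q + 1) by ring, Real.exp_add (-3)]; ring
    _ ≤ 1 / 2 * Real.exp (-12) * (‖z‖ ^ 2 * Real.exp z.re) := by
        gcongr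
        linarith
    _ ≤ _ := key

lemma parabolic_ne_zero {k : ℕ} {c d : ℝ} (hk : 1 ≤ k) (hc : |c| ≤ Real.pi / 2) :
    -(((k * Real.pi + c : ℝ) : ℂ) + d * Complex.I) ^ 2 ≠ 0 := by
  refine neg_ne_zero.2 (pow_ne_zero 2 fun h => ?_)
  have h1 := congrArg Complex.re h
  simp only [Complex.add_re, Complex.ofReal_re, Complex.mul_re, Complex.I_re, Complex.I_im,
    Complex.ofReal_im, Complex.zero_re] at h1
  have h2 := (abs_le.1 hc).1
  have h3 : (1 : ℝ) ≤ k := by exact_mod_cast hk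
  nlinarith [Real.pi_pos]

lemma hyperbolic_ne_zero {k : ℤ} {a b : ℝ} (hk : 1 ≤ |k|) (hb : |b| ≤ Real.pi / 2) :
    -(((1 + a : ℝ) : ℂ) + ((2 * k * Real.pi + b : ℝ) : ℂ) * Complex.I) ≠ 0 := by
  refine neg_ne_zero.2 fun h => ?_
  have h1 := congrArg Complex.im h
  simp only [Complex.add_im, Complex.ofReal_re, Complex.mul_im, Complex.I_re, Complex.I_im,
    Complex.ofReal_im, Complex.zero_im] at h1
  have h2 : b = -(2 * (k * Real.pi)) := by linarith
  have h3 : (1 : ℝ) ≤ |(k : ℝ)| := by exact_mod_cast hk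
  rw [h2, abs_neg, abs_mul, abs_two, abs_mul, abs_of_pos Real.pi_pos] at hb
  nlinarith [Real.pi_pos]

end

/-! ### Conclusion: large indices by asymptotics, the finitely many others by nonvanishing -/

theorem lemma4p2 :
    -- the two branches of eigenvalues and eigenfunctions exist
    (∃ k₀ : ℕ, 1 ≤ k₀ ∧
      ∃ (lamP : ℕ → ℂ) (ΦP : ℕ → State) (lamH : ℤ → ℂ) (ΦH : ℤ → State),
        IsParabolicBranch k₀ lamP ΦP ∧ IsHyperbolicBranch k₀ lamH ΦH) ∧
    -- and their observations are bounded from below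
    (∀ k₀ : ℕ, 1 ≤ k₀ →
      (∀ (lamP : ℕ → ℂ) (ΦP : ℕ → State), IsParabolicBranch k₀ lamP ΦP →
        ∃ C : ℝ, 0 < C ∧ ∀ k : ℕ, k₀ ≤ k →
          C / (k * Real.pi) ≤ ‖observation (ΦP k)‖) ∧
      (∀ (lamH : ℤ → ℂ) (ΦH : ℤ → State), IsHyperbolicBranch k₀ lamH ΦH →
        ∃ C : ℝ, 0 < C ∧ ∀ k : ℤ, (k₀ : ℤ) ≤ |k| →
          C ≤ ‖observation (ΦH k)‖)) := by
  refine ⟨?_, fun k₀ hk₀ => ⟨fun lamP ΦP hP => ?_, fun lamH ΦH hH => ?_⟩⟩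
  · obtain ⟨K₁, h₁⟩ := exists_parabolicBranch
    obtain ⟨K₂, h₂⟩ := exists_hyperbolicBranch
    obtain ⟨lamP, ΦP, hP⟩ := h₁ (max 1 (max K₁ K₂)) (by simp)
    obtain ⟨lamH, ΦH, hH⟩ := h₂ (max 1 (max K₁ K₂)) (by simp)
    exact ⟨_, le_max_left _ _, lamP, ΦP, lamH, ΦH, hP, hH⟩
  · obtain ⟨K, hK⟩ := parabolic_lower_bound
    have hpos : ∀ k : ℕ, k₀ ≤ k → 0 < (k : ℝ) * Real.pi := fun k hk => by
      have : (1 : ℝ) ≤ k := by exact_mod_cast hk₀.trans hk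
      have := Real.pi_pos
      positivity
    obtain ⟨C, hC, hCle⟩ := exists_pos_le_of_finite (S := {k | k₀ ≤ k}) (T := {k | k < K})
      (g := fun k => ‖observation (ΦP k)‖ * (k * Real.pi)) (c := Real.exp (-1) / 3) (by positivity)
      (Set.finite_lt_nat K)
      (fun k hk => by
        obtain ⟨⟨c, d, hc, hd, hlam⟩, he, hr⟩ := hP k hk
        have hl : lamP k ≠ 0 := hlam ▸ parabolic_ne_zero (hk₀.trans hk) hc
        exact mul_pos (norm_pos_iff.2 (observation_ne_zero hl he hr)) (hpos k hk))
      (fun k hk hkT => by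
        obtain ⟨⟨c, d, hc, hd, hlam⟩, he, hr⟩ := hP k hk
        have hl : lamP k ≠ 0 := hlam ▸ parabolic_ne_zero (hk₀.trans hk) hc
        exact hK k _ _ c d (not_lt.1 hkT) hc hd hlam hl hr)
    exact ⟨C, hC, fun k hk => (div_le_iff₀ (hpos k hk)).2 (hCle k hk)⟩
  · obtain ⟨K, c₀, hc₀, hK⟩ := hyperbolic_lower_bound
    refine exists_pos_le_of_finite (S := {k : ℤ | (k₀ : ℤ) ≤ |k|}) (T := {k : ℤ | |k| ≤ ⌈K⌉})
      (g := fun k => ‖observation (ΦH k)‖) hc₀ ?_ (fun k hk => ?_) (fun k hk hkT => ?_)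
    · exact (Set.finite_Icc (-⌈K⌉) ⌈K⌉).subset fun k hk => abs_le.1 hk
    · have hk1 : 1 ≤ |k| := le_trans (by exact_mod_cast hk₀) hk
      obtain ⟨⟨a, b, ha, hb, hlam⟩, he, Φ₀, hr, hΦ⟩ := hH k hk
      have hl : lamH k ≠ 0 := hlam ▸ hyperbolic_ne_zero hk1 hb
      have hs : (hypScale k : ℂ) ≠ 0 := Complex.ofReal_ne_zero.2
        (hypScale_ne_zero (abs_pos.1 (lt_of_lt_of_le one_pos hk1)))
      -- Nonvanishing concerns the unscaled reference pair, so the scaling is undone before it is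
      -- applied.
      have he' : IsEigenfunction (lamH k) Φ₀ := by
        have := he.smul hs
        rwa [hΦ, smul_inv_smul₀ hs] at this
      have := observation_ne_zero hl he' hr
      refine norm_pos_iff.2 ?_
      rw [hΦ]
      exact mul_ne_zero (inv_ne_zero hs) this
    · have hk1 : 1 ≤ |k| := le_trans (by exact_mod_cast hk₀) hk
      obtain ⟨⟨a, b, ha, hb, hlam⟩, he, Φ₀, hr, hΦ⟩ := hH k hk
      have hl : lamH k ≠ 0 := hlam ▸ hyperbolic_ne_zero hk1 hb
      rw [hΦ]
      refine hK k _ _ a b ?_ ha hb hlam hl hr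
      have h1 : ⌈K⌉ < |k| := not_le.1 hkT
      have h2 : ((⌈K⌉ : ℤ) : ℝ) ≤ ((|k| : ℤ) : ℝ) := by exact_mod_cast h1.le
      rw [Int.cast_abs] at h2
      exact (Int.le_ceil K).trans h2
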